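/- Let $k:[-1,1]^2\to\mathbb R$ be a measurable, square-integrable covariance kernel (for all $x_1,\dots,x_N\in[-1,1]$ the matrix $(k(x_i,x_j))_{i,j}$ is symmetric positive semidefinite), and let $\mathcal K v(x)=\int_{-1}^1 k(x,x')\,v(x')\,dx'$ be the associated integral operator on $L^2[-1,1]$. Let $\lambda_1\ge\lambda_2\ge\cdots$ and $u_1,u_2,\dots$ be its eigenvalues, listed with multiplicity, and corresponding $L^2$-orthonormal eigenfunctions (every eigenfunction with nonzero eigenvalue that is orthogonal to all $u_i$ vanishes almost everywhere), and put $\hat k_m(x,x')=\sum_{i=1}^m\lambda_i u_i(x)u_i(x')$. (1) For every $m$ and every random vector $\alpha\sim\mathcal N(0,I)$ in $\mathbb R^m$, the truncated Karhunen–Loève expansion $\hat f(x)=\sum_{i=1}^m\alpha_i\sqrt{\lambda_i}\,u_i(x)$, $x\in[-1,1]$, is a mean-zero Gaussian process with covariance function $\hat k_m$: for all $x_1,\dots,x_N\in[-1,1]$ the vector $(\hat f(x_1),\dots,\hat f(x_N))$ has law $\mathcal N\big(0,(\hat k_m(x_a,x_b))_{a,b}\big)$. (2) Let $\|\cdot\|_2$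 be the norm of $L^2([-1,1]^2)$. (a) If $k$ is smooth in the sense of being real-analytic on $[-1,1]^2$ (at each point of the closed square it is given, near that point within the square, by a convergent power series), then $\|k-\hat k_m\|_2^2$ decays exponentially in $m$: there are $C$ and $\rho\in(0,1)$ with $\|k-\hat k_m\|_2^2\le C\rho^m$ for all $m$. If $k$ is only $C^\infty$ on $[-1,1]^2$, the decay is super-algebraic: $\|k-\hat k_m\|_2^2=O(1/m^q)$ as $m\to\infty$ for every $q$. (b) If $j\ge 0$ and $k$ has continuous derivatives up to order $j$ on $[-1,1]^2$, then $\|k-\hat k_m\|_2^2=O(1/m^{j+1})$ as $m\to\infty$. -/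

import Mathlib

open MeasureTheory ProbabilityTheory Filter Asymptotics
open scoped ContDiff

noncomputable section

namespace KLExpansion

/-- The interval `[-1, 1]`. -/
abbrev I : Set ℝ := Set.Icc (-1) 1

/-- `k` is a square-integrable covariance kernel on `[-1, 1]`: measurable and square-integrable
on `[-1, 1]²`, and every matrix `(k (x i) (x j))` with points `x i` in `[-1, 1]` is symmetric
positive semidefinite. Values of `k` outside `[-1, 1]²` play no role. -/
structure IsCovarianceKernel (k : ℝ → ℝ → ℝ) : Prop where
  measurable : Measurable (fun p : I × I => k p.1 p.2)
  memLp : MemLp (fun p : ℝ × ℝ => k p.1 p.2) 2 (volume.restrict (I ×ˢ I))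
  posSemidef : ∀ (N : ℕ) (x : Fin N → I),
    (Matrix.of fun i j : Fin N => k (x i) (x j)).PosSemidef

/-- The integral operator `(K v)(x) = ∫_{-1}^{1} k(x, y) v(y) dy`. -/
def integralOp (k : ℝ → ℝ → ℝ) (v : ℝ → ℝ) (x : ℝ) : ℝ :=
  ∫ y in I, k x y * v y

/-- `v ∈ L²[-1, 1]` satisfies `K v = c v` in `L²[-1, 1]`. -/
def SatisfiesEigenEq (k : ℝ → ℝ → ℝ) (c : ℝ) (v : ℝ → ℝ) : Prop :=
  MemLp v 2 (volume.restrict I) ∧ ∀ᵐ x ∂(volume.restrict I), integralOp k v x = c * v x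

/-- `(lam i, u i)`, `i = 0, 1, 2, …`, are the eigenvalues and the eigenfunctions of the integral
operator of `k` on `L²[-1, 1]`: the eigenvalues are in nonincreasing order, the eigenfunctions are
`L²`-orthonormal, and none with nonzero eigenvalue is missing (so each nonzero eigenvalue is
repeated according to its multiplicity). -/
structure IsEigensystem (k : ℝ → ℝ → ℝ) (lam : ℕ → ℝ) (u : ℕ → ℝ → ℝ) : Prop where
  antitone : Antitone lam
  eigen : ∀ i, SatisfiesEigenEq k (lam i) (u i)
  orthonormal : ∀ i j, ∫ x in I, u i x * u j x = if i = j then 1 else 0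
  complete : ∀ (c : ℝ) (v : ℝ → ℝ), c ≠ 0 → SatisfiesEigenEq k c v →
    (∀ i, ∫ x in I, u i x * v x = 0) → ∀ᵐ x ∂(volume.restrict I), v x = 0

/-- The scaled eigenfunctions `φ_i = √λ_i u_i`. -/
def phi (lam : ℕ → ℝ) (u : ℕ → ℝ → ℝ) (i : ℕ) (x : ℝ) : ℝ :=
  Real.sqrt (lam i) * u i x

/-- The order-`m` expansion `∑_{i < m} a_i φ_i(x)` with coefficient vector `a`. -/
def klSum (lam : ℕ → ℝ) (u : ℕ → ℝ → ℝ) {m : ℕ} (a : EuclideanSpace ℝ (Fin m)) (x : ℝ) : ℝ :=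
  ∑ i : Fin m, a i * phi lam u i x

/-- The kernel `∑_{i < m} λ_i u_i(x) u_i(y)`. -/
def klKernel (lam : ℕ → ℝ) (u : ℕ → ℝ → ℝ) (m : ℕ) (x y : ℝ) : ℝ :=
  ∑ i ∈ Finset.range m, lam i * u i x * u i y

/-- `‖k - k'‖₂²`, the norm being that of `L²([-1, 1]²)`. -/
def sqDist (k k' : ℝ → ℝ → ℝ) : ℝ :=
  ∫ p in I ×ˢ I, (k p.1 p.2 - k' p.1 p.2) ^ 2

/-- Under `P`, the random function `f` is a Gaussian process on `T` with mean function `mean` and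
covariance function `cov`: for all points `x 1, …, x N`, the vector `(f (x 1), …, f (x N))` has
the normal law with mean `(mean (x i))_i` and positive semidefinite covariance matrix
`(cov (x i) (x j))_{i j}` (which may be singular). -/
def IsGaussianProcessWith {Ω T : Type*} [MeasurableSpace Ω] (P : Measure Ω) (f : T → Ω → ℝ)
    (mean : T → ℝ) (cov : T → T → ℝ) : Prop :=
  ∀ (N : ℕ) (x : Fin N → T),
    (Matrix.of fun i j : Fin N => cov (x i) (x j)).PosSemidef ∧
    HasLaw (fun w => WithLp.toLp 2 fun i : Fin N => f (x i) w)
      (multivariateGaussian (WithLp.toLp 2 fun i : Fin N => mean (x i))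
        (Matrix.of fun i j : Fin N => cov (x i) (x j))) P

end KLExpansion

end

namespace KLExpansion

/-! ### The law of the truncated expansion. -/

section Gaussian

open scoped InnerProductSpace

/-! The values of the expansion at finitely many points are a linear image of a standard Gaussian
vector, hence Gaussian, and their covariance is the Gram matrix of the vectors `(√λ_i u_i(x_a))_i`,
which is the matrix of `klKernel` as soon as `λ_i ≥ 0`. Nonnegativity must be derived from the
finite matrices: `λ_i` is the quadratic form of `k` at `u_i`, and such a double integral is a limit
of averages of finite double sums over independent random points (`integral_kernel_mul_mul_nonneg`).

The decay rates come from Schmidt's theorem, that the truncated eigenexpansion is the best rank-`m`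
approximation. Let `T` be the integral operator. By orthogonality the squared error is `∫ ‖k(x,·)‖²
dx - ∑_{i<m} λ_i²` (`sqDist_eq`). If all sections `k(x,·)` lie within `ε` of a space `V` with `dim V
≤ m` and orthonormal basis `v_j`, then Pythagoras bounds the first term by `2ε² + ∑ ‖T v_j‖²`, and
Ky Fan's inequality (`sum_norm_apply_sq_le`) bounds the last sum by `∑_{i<m} λ_i²`. So the squared
error is at most `2ε²` (`sqDist_le_of_slicesNear`), and the spectral problem becomes one of
approximating sections.

Take `V` to be the piecewise polynomials of degree less than `n` on `N` equal cells, of dimension at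
most `N n`. For `C^j` kernels with `j ≥ 1`, fix `n = j` and let `N` grow like `m / j`: Taylor's
formula gives `ε = O(m^{-j})`, and `2j ≥ j + 1`. For analytic kernels, fix cells small enough for
local power series to converge geometrically and let `n` grow like `m / N`.

Continuity alone gives no rate this way. There positivity enters again: the sum of the eigenvalues
is bounded by the trace (`sum_eigenvalues_le`), so `λ_m = O(1/m)` and the tail of `∑ λ_i²` is at
most `λ_m ∑ λ_i = O(1/m)`. -/

theorem posSemidef_klKernel {lam : ℕ → ℝ} (h0 : ∀ i, 0 ≤ lam i) (u : ℕ → ℝ → ℝ) (m : ℕ)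
    {N : ℕ} (x : Fin N → ℝ) :
    (Matrix.of fun i j : Fin N => klKernel lam u m (x i) (x j)).PosSemidef := by
  have : (Matrix.of fun i j : Fin N => klKernel lam u m (x i) (x j)) =
      (Matrix.of fun (i : Fin m) (j : Fin N) => phi lam u i (x j)).conjTranspose *
        (Matrix.of fun (i : Fin m) (j : Fin N) => phi lam u i (x j)) := by
    ext a b
    simp only [Matrix.of_apply, klKernel, Matrix.mul_apply, Matrix.conjTranspose_apply, phi,
      star_trivial, Finset.sum_range]
    refine Finset.sum_congr rfl fun i _ => ?_
    have := Real.mul_self_sqrt (h0 i)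
    calc lam i * u i (x a) * u i (x b)
        = (√(lam i) * √(lam i)) * u i (x a) * u i (x b) := by rw [this]
      _ = _ := by ring
  rw [this]
  exact Matrix.posSemidef_conjTranspose_mul_self _

/-- The linear map sending a coefficient vector to the values of the expansion. -/
noncomputable def evalCLM (lam : ℕ → ℝ) (u : ℕ → ℝ → ℝ) (m : ℕ) {N : ℕ} (x : Fin N → ℝ) :
    EuclideanSpace ℝ (Fin m) →L[ℝ] EuclideanSpace ℝ (Fin N) :=
  LinearMap.toContinuousLinearMap
    { toFun := fun a => WithLp.toLp 2 fun j => klSum lam u a (x j)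
      map_add' := by
        intro a b; ext j; simp [klSum, add_mul, Finset.sum_add_distrib]
      map_smul' := by
        intro c a; ext j; simp [klSum, Finset.mul_sum, mul_assoc] }

/-- Characteristic functions agree: moving the linear map to the other side of the inner product
replaces `t` by its adjoint image `s`, and `‖s‖²` is the quadratic form of the covariance matrix at
`t`. -/
theorem map_stdGaussian_evalCLM {lam : ℕ → ℝ} (h0 : ∀ i, 0 ≤ lam i) (u : ℕ → ℝ → ℝ) (m : ℕ)
    {N : ℕ} (x : Fin N → ℝ) :
    (stdGaussian (EuclideanSpace ℝ (Fin m))).map (evalCLM lam u m x) =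
      multivariateGaussian 0 (Matrix.of fun i j : Fin N => klKernel lam u m (x i) (x j)) := by
  apply Measure.ext_of_charFun
  ext t
  rw [charFun_multivariateGaussian (posSemidef_klKernel h0 u m x), charFun_apply,
    integral_map (by fun_prop) (by fun_prop)]
  set s : EuclideanSpace ℝ (Fin m) := WithLp.toLp 2 fun i => ∑ j, phi lam u i (x j) * t j with hs
  have h1 : ∀ a, ⟪evalCLM lam u m x a, t⟫_ℝ = ⟪a, s⟫_ℝ := by
    intro a
    simp only [evalCLM, hs, PiLp.inner_apply, LinearMap.coe_toContinuousLinearMap',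
      LinearMap.coe_mk, AddHom.coe_mk, klSum]
    simp only [RCLike.inner_apply, conj_trivial, Finset.mul_sum, Finset.sum_mul]
    rw [Finset.sum_comm]
    refine Finset.sum_congr rfl fun i _ => Finset.sum_congr rfl fun j _ => ?_
    ring
  simp_rw [h1]
  rw [← charFun_apply, charFun_stdGaussian]
  congr 1
  have h2 : t.ofLp ⬝ᵥ (Matrix.of fun i j : Fin N => klKernel lam u m (x i) (x j)).mulVec t.ofLp
      = ‖s‖ ^ 2 := by
    rw [EuclideanSpace.real_norm_sq_eq]
    simp only [dotProduct, Matrix.mulVec, Matrix.of_apply, klKernel, hs, Finset.sum_range,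
      Finset.mul_sum, Finset.sum_mul, sq]
    rw [Finset.sum_congr rfl fun a _ => Finset.sum_comm, Finset.sum_comm]
    refine Finset.sum_congr rfl fun i _ => Finset.sum_congr rfl fun a _ =>
      Finset.sum_congr rfl fun b _ => ?_
    have := Real.mul_self_sqrt (h0 i)
    simp only [phi]
    calc _ = lam i * (t.ofLp a * u i (x a) * u i (x b) * t.ofLp b) := by ring
      _ = (√(lam i) * √(lam i)) * (t.ofLp a * u i (x a) * u i (x b) * t.ofLp b) := by rw [this]
      _ = _ := by ring
  rw [h2]
  simp [neg_div]

theorem isGaussianProcessWith_klSum {lam : ℕ → ℝ} (h0 : ∀ i, 0 ≤ lam i) (u : ℕ → ℝ → ℝ)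
    {Ω : Type*} [MeasurableSpace Ω] (P : Measure Ω) (m : ℕ)
    (α : Ω → EuclideanSpace ℝ (Fin m)) (hα : HasLaw α (multivariateGaussian 0 1) P) :
    IsGaussianProcessWith P (fun (x : I) w => klSum lam u (α w) x) (fun _ => 0)
      (fun x y => klKernel lam u m x y) := by
  intro N x
  refine ⟨posSemidef_klKernel h0 u m fun i => (x i : ℝ), ?_⟩
  have h : HasLaw (evalCLM lam u m fun i => (x i : ℝ))
      (multivariateGaussian 0 (Matrix.of fun i j : Fin N => klKernel lam u m (x i) (x j)))
      (multivariateGaussian 0 (1 : Matrix (Fin m) (Fin m) ℝ)) := by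
    refine ⟨by fun_prop, ?_⟩
    rw [multivariateGaussian_zero_one]
    exact map_stdGaussian_evalCLM h0 u m fun i => (x i : ℝ)
  exact h.comp hα

end Gaussian

/-! ### Positive double integrals by random sampling. -/

section Positivity

variable {α : Type*} [MeasurableSpace α]

/-- The double integral of a kernel all of whose double sums are nonnegative is nonnegative:
average the double sums over independent samples. -/
theorem integral_prod_nonneg_of_sum_nonneg {ν : Measure α} [IsProbabilityMeasure ν]
    {g : α → α → ℝ} (hg : Integrable (fun p : α × α => g p.1 p.2) (ν.prod ν))
    (hd : Integrable (fun x => g x x) ν)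
    (hpos : ∀ (N : ℕ) (x : Fin N → α), 0 ≤ ∑ i, ∑ j, g (x i) (x j)) :
    0 ≤ ∫ p, g p.1 p.2 ∂(ν.prod ν) := by
  set Q := ∫ p, g p.1 p.2 ∂(ν.prod ν) with hQ
  set D := ∫ x, g x x ∂ν with hD
  have hmp : ∀ (N : ℕ) (i j : Fin N), i ≠ j → MeasurePreserving
      (fun x : Fin N → α => (x i, x j)) (Measure.pi fun _ => ν) (ν.prod ν) := by
    intro N i j hij
    have hind := (iIndepFun_pi (μ := fun _ : Fin N => ν) (X := fun _ => id)
      (fun _ => aemeasurable_id)).indepFun hij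
    have := hind.map_prod_eq_prod_map_map (measurable_pi_apply i).aemeasurable
      (measurable_pi_apply j).aemeasurable
    have e : ∀ i : Fin N, (Measure.pi fun _ => ν).map (fun x : Fin N → α => x i) = ν := fun i =>
      (measurePreserving_eval (fun _ : Fin N => ν) i).map_eq
    exact ⟨by fun_prop, this.trans (congrArg₂ Measure.prod (e i) (e j))⟩
  have hint : ∀ (N : ℕ) (i j : Fin N), Integrable (fun x : Fin N → α => g (x i) (x j))
      (Measure.pi fun _ => ν) ∧ ∫ x, g (x i) (x j) ∂(Measure.pi fun _ : Fin N => ν) =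
        if i = j then D else Q := by
    intro N i j
    split_ifs with hij
    · subst hij
      have h := measurePreserving_eval (fun _ : Fin N => ν) i
      refine ⟨h.integrable_comp_of_integrable hd, ?_⟩
      rw [hD]
      conv_rhs => rw [← h.map_eq]
      rw [integral_map h.measurable.aemeasurable (by rw [h.map_eq]; exact hd.1)]
    · have h := hmp N i j hij
      refine ⟨h.integrable_comp_of_integrable hg, ?_⟩
      rw [hQ]
      conv_rhs => rw [← h.map_eq]
      rw [integral_map h.measurable.aemeasurable]
      rw [h.map_eq]; exact hg.1
  -- Expectation of the double sum over `N` independent samples: `N` diagonal terms contribute `D`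
  -- each, the other `N² - N` contribute `Q`.
  have hN : ∀ N : ℕ, 0 ≤ (N : ℝ) * D + (N * N - N) * Q := by
    intro N
    have h1 : 0 ≤ ∫ x, ∑ i, ∑ j, g (x i) (x j) ∂(Measure.pi fun _ : Fin N => ν) :=
      integral_nonneg fun x => hpos N x
    rw [integral_finsetSum _ fun i _ => integrable_finsetSum _ fun j _ => (hint N i j).1] at h1
    simp_rw [integral_finsetSum _ fun j _ => (hint N _ j).1, (hint N _ _).2] at h1
    have h2 : ∀ i : Fin N, ∑ j : Fin N, (if i = j then D else Q) = N * Q + (D - Q) := by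
      intro i
      have : ∀ j : Fin N, (if i = j then D else Q) = Q + if i = j then D - Q else 0 := by
        intro j; split_ifs <;> ring
      simp [this, Finset.sum_add_distrib]
    simp_rw [h2] at h1
    simp at h1
    linarith
  -- As `N` grows the `N²` term dominates; if `Q < 0`, this `n` makes `D + (n - 1) Q` negative.
  by_contra! hneg
  obtain ⟨n, hn⟩ := exists_nat_gt ((|D| + 1 - Q) / (-Q))
  rw [div_lt_iff₀ (by linarith)] at hn
  have hn0 : (0 : ℝ) < n := by
    rcases Nat.eq_zero_or_pos n with h | h
    · subst h; simp at hn; have := abs_nonneg D; linarith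
    · exact_mod_cast h
  have h3 := hN n
  have h4 : (n : ℝ) * D + (n * n - n) * Q = n * (D - (n * (-Q) + Q)) := by ring
  rw [h4] at h3
  have h5 : 0 ≤ D - (n * (-Q) + Q) := by
    by_contra! h
    nlinarith
  have := le_abs_self D
  linarith

end Positivity

/-! ### Quadratic forms of square-integrable kernels. -/

section Positivity

variable {α : Type*} [MeasurableSpace α]

/-- Normalizing `μ` to a probability measure multiplies the double integral by a positive constant.
-/
theorem integral_prod_nonneg_of_sum_nonneg' {μ : Measure α} [IsFiniteMeasure μ]
    {g : α → α → ℝ} (hg : Integrable (fun p : α × α => g p.1 p.2) (μ.prod μ))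
    (hd : Integrable (fun x => g x x) μ)
    (hpos : ∀ (N : ℕ) (x : Fin N → α), 0 ≤ ∑ i, ∑ j, g (x i) (x j)) :
    0 ≤ ∫ p, g p.1 p.2 ∂(μ.prod μ) := by
  rcases eq_or_ne μ 0 with rfl | h0
  · simp
  have : NeZero μ := ⟨h0⟩
  set c := (μ Set.univ)⁻¹ with hc
  have hc0 : c ≠ 0 := ENNReal.inv_ne_zero.2 (measure_ne_top _ _)
  have hct : c ≠ ⊤ := ENNReal.inv_ne_top.2 (by simpa using h0)
  have hprob : IsProbabilityMeasure (c • μ) := isProbabilityMeasureSMul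
  have hprod : (c • μ).prod (c • μ) = c • c • μ.prod μ := by
    rw [Measure.prod_smul_left, Measure.prod_smul_right]
  have := integral_prod_nonneg_of_sum_nonneg (ν := c • μ) (g := g)
    (by rw [hprod]; exact (hg.smul_measure hct).smul_measure hct) (hd.smul_measure hct) hpos
  rw [hprod, integral_smul_measure, integral_smul_measure, smul_eq_mul, smul_eq_mul] at this
  have hcr : 0 < c.toReal := ENNReal.toReal_pos hc0 hct
  exact (mul_nonneg_iff_of_pos_left hcr).1 ((mul_nonneg_iff_of_pos_left hcr).1 this)

theorem memLp_two_mul_prod {β : Type*} [MeasurableSpace β] {μ : Measure α} {ν : Measure β}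
    [SFinite μ] [SFinite ν] {v : α → ℝ} {w : β → ℝ} (hv : MemLp v 2 μ)
    (hw : MemLp w 2 ν) : MemLp (fun p : α × β => v p.1 * w p.2) 2 (μ.prod ν) := by
  have hm : AEStronglyMeasurable (fun p : α × β => v p.1 * w p.2) (μ.prod ν) :=
    hv.1.comp_fst.mul hw.1.comp_snd
  rw [memLp_two_iff_integrable_sq hm]
  simp only [mul_pow]
  exact hv.integrable_sq.mul_prod hw.integrable_sq

/-- The quadratic form of a square-integrable kernel with nonnegative finite quadratic forms is
nonnegative. -/
theorem integral_kernel_mul_mul_nonneg {μ : Measure α} [IsFiniteMeasure μ] {K : α → α → ℝ}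
    (hK : Measurable (fun p : α × α => K p.1 p.2))
    (hL : MemLp (fun p : α × α => K p.1 p.2) 2 (μ.prod μ))
    (hpos : ∀ (N : ℕ) (x : Fin N → α) (c : Fin N → ℝ),
      0 ≤ ∑ i, ∑ j, c i * c j * K (x i) (x j))
    {v : α → ℝ} (hv : MemLp v 2 μ) :
    0 ≤ ∫ p, K p.1 p.2 * (v p.1 * v p.2) ∂(μ.prod μ) := by
  have hvv := memLp_two_mul_prod hv hv
  have hI : Integrable (fun p : α × α => K p.1 p.2 * (v p.1 * v p.2)) (μ.prod μ) :=
    hL.integrable_mul hvv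
  have hKd : Measurable fun x => K x x := hK.comp (measurable_id.prodMk measurable_id)
  have hdiag : ∀ x, 0 ≤ K x x := fun x => by simpa using hpos 1 (fun _ => x) (fun _ => 1)
  -- The diagonal has measure zero in general, so square-integrability of `K` says nothing about `K
  -- x x`. Cutting `v` off to the sets where `K x x ≤ n` makes the diagonal term integrable;
  -- dominated convergence then removes the cutoff.
  set A : ℕ → Set α := fun n => {x | K x x ≤ n} with hA
  have hAm : ∀ n, MeasurableSet (A n) := fun n => measurableSet_le hKd measurable_const
  set w : ℕ → α → ℝ := fun n => (A n).indicator v with hw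
  have hwm : ∀ n, AEStronglyMeasurable (w n) μ := fun n => hv.1.indicator (hAm n)
  have hwv : ∀ n x, |w n x| ≤ |v x| := by
    intro n x
    simp only [hw, Set.indicator]
    split_ifs <;> simp
  have hm : ∀ n, AEStronglyMeasurable (fun p : α × α => K p.1 p.2 * (w n p.1 * w n p.2))
      (μ.prod μ) := fun n =>
    hK.aestronglyMeasurable.mul ((hwm n).comp_fst.mul (hwm n).comp_snd)
  have hb : ∀ n (p : α × α), ‖K p.1 p.2 * (w n p.1 * w n p.2)‖ ≤
      ‖K p.1 p.2 * (v p.1 * v p.2)‖ := by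
    intro n p
    simp only [norm_mul, Real.norm_eq_abs]
    exact mul_le_mul_of_nonneg_left (mul_le_mul (hwv n p.1) (hwv n p.2) (abs_nonneg _)
      (abs_nonneg _)) (abs_nonneg _)
  have hpn : ∀ n, 0 ≤ ∫ p, K p.1 p.2 * (w n p.1 * w n p.2) ∂(μ.prod μ) := by
    intro n
    refine integral_prod_nonneg_of_sum_nonneg' (g := fun x y => K x y * (w n x * w n y))
      (hI.mono (hm n) (.of_forall (hb n))) ?_ ?_
    · refine (hv.integrable_sq.const_mul (n : ℝ)).mono
        (hKd.aestronglyMeasurable.mul ((hwm n).mul (hwm n))) (.of_forall fun x => ?_)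
      simp only [hw, Set.indicator]
      split_ifs with hx
      · have hx' : K x x ≤ n := hx
        rw [Real.norm_of_nonneg (mul_nonneg (hdiag x) (mul_self_nonneg _)),
          Real.norm_of_nonneg (by positivity), sq]
        exact mul_le_mul_of_nonneg_right hx' (mul_self_nonneg _)
      · simp only [mul_zero, norm_zero]
        exact norm_nonneg _
    · intro N x
      refine (hpos N x fun i => w n (x i)).trans (le_of_eq ?_)
      refine Finset.sum_congr rfl fun i _ => Finset.sum_congr rfl fun j _ => ?_
      ring
  have hlim : Tendsto (fun n => ∫ p, K p.1 p.2 * (w n p.1 * w n p.2) ∂(μ.prod μ)) atTop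
      (nhds (∫ p, K p.1 p.2 * (v p.1 * v p.2) ∂(μ.prod μ))) := by
    refine tendsto_integral_of_dominated_convergence _ hm hI.norm
      (fun n => .of_forall (hb n)) (.of_forall fun p => ?_)
    refine tendsto_const_nhds.congr' ?_
    filter_upwards [eventually_ge_atTop ⌈K p.1 p.1⌉₊, eventually_ge_atTop ⌈K p.2 p.2⌉₊]
      with n h1 h2
    have e1 : p.1 ∈ A n := (Nat.le_ceil (K p.1 p.1)).trans (Nat.cast_le.2 h1)
    have e2 : p.2 ∈ A n := (Nat.le_ceil (K p.2 p.2)).trans (Nat.cast_le.2 h2)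
    simp only [hw, Set.indicator_of_mem e1, Set.indicator_of_mem e2]
  exact ge_of_tendsto' hlim hpn

end Positivity

/-! ### Extending the kernel from the square to the plane. -/

section Clamp

/-- The nearest point of `[-1, 1]`. -/
noncomputable def clamp (x : ℝ) : ℝ := Set.projIcc (-1 : ℝ) 1 (by norm_num) x

theorem clamp_mem (x : ℝ) : clamp x ∈ I := Subtype.coe_prop _

theorem clamp_of_mem {x : ℝ} (hx : x ∈ I) : clamp x = x := by
  rw [clamp, Set.projIcc_of_mem _ hx]

theorem continuous_clamp : Continuous clamp :=
  continuous_subtype_val.comp continuous_projIcc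

/-- The extension of a kernel on `[-1, 1]²` to the plane that is constant beyond the boundary. -/
noncomputable def clampKernel (k : ℝ → ℝ → ℝ) (x y : ℝ) : ℝ := k (clamp x) (clamp y)

theorem clampKernel_of_mem (k : ℝ → ℝ → ℝ) {x y : ℝ} (hx : x ∈ I) (hy : y ∈ I) :
    clampKernel k x y = k x y := by
  rw [clampKernel, clamp_of_mem hx, clamp_of_mem hy]

variable {k : ℝ → ℝ → ℝ}

theorem IsCovarianceKernel.measurable_clampKernel (hk : IsCovarianceKernel k) :
    Measurable (fun p : ℝ × ℝ => clampKernel k p.1 p.2) := by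
  have : Measurable fun p : ℝ × ℝ =>
      ((⟨clamp p.1, clamp_mem _⟩, ⟨clamp p.2, clamp_mem _⟩) : I × I) :=
    ((continuous_clamp.measurable.comp measurable_fst).subtype_mk).prodMk
      ((continuous_clamp.measurable.comp measurable_snd).subtype_mk)
  exact hk.measurable.comp this

theorem IsCovarianceKernel.sum_clampKernel_nonneg (hk : IsCovarianceKernel k) (N : ℕ)
    (x : Fin N → ℝ) (c : Fin N → ℝ) :
    0 ≤ ∑ i, ∑ j, c i * c j * clampKernel k (x i) (x j) := by
  have h := (hk.posSemidef N fun i => ⟨clamp (x i), clamp_mem _⟩).dotProduct_mulVec_nonneg c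
  refine h.trans (le_of_eq ?_)
  simp only [dotProduct, Matrix.mulVec, Matrix.of_apply, Finset.mul_sum, star_trivial, clampKernel]
  refine Finset.sum_congr rfl fun i _ => Finset.sum_congr rfl fun j _ => ?_
  ring

theorem IsCovarianceKernel.clampKernel_comm (hk : IsCovarianceKernel k) (x y : ℝ) :
    clampKernel k x y = clampKernel k y x := by
  have h := (hk.posSemidef 2 ![⟨clamp x, clamp_mem _⟩, ⟨clamp y, clamp_mem _⟩]).1.apply 0 1
  simpa [clampKernel] using h.symm

theorem ae_mem_I_prod : ∀ᵐ p ∂((volume.restrict I).prod (volume.restrict I)),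
    p.1 ∈ I ∧ p.2 ∈ I := by
  rw [Measure.prod_restrict]
  exact (ae_restrict_mem (measurableSet_Icc.prod measurableSet_Icc)).mono fun p hp => hp

theorem IsCovarianceKernel.memLp_clampKernel (hk : IsCovarianceKernel k) :
    MemLp (fun p : ℝ × ℝ => clampKernel k p.1 p.2) 2
      ((volume.restrict I).prod (volume.restrict I)) := by
  have h := hk.memLp
  rw [Measure.volume_eq_prod, ← Measure.prod_restrict] at h
  refine h.ae_eq ?_
  filter_upwards [ae_mem_I_prod] with p hp
  exact (clampKernel_of_mem k hp.1 hp.2).symm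

theorem integralOp_clampKernel (v : ℝ → ℝ) {x : ℝ} (hx : x ∈ I) :
    integralOp (clampKernel k) v x = integralOp k v x :=
  setIntegral_congr_fun measurableSet_Icc fun y hy => by
    simp only [clampKernel_of_mem k hx hy]

theorem satisfiesEigenEq_clampKernel_iff (c : ℝ) (v : ℝ → ℝ) :
    SatisfiesEigenEq (clampKernel k) c v ↔ SatisfiesEigenEq k c v := by
  refine and_congr_right fun _ => eventually_congr ?_
  filter_upwards [ae_restrict_mem measurableSet_Icc] with x hx
  rw [integralOp_clampKernel v hx]

/-- The eigenvalue problem sees `k` only on the square, so the clamped kernel may replace it, with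
measurability, symmetry and positivity now available on the whole plane. -/
theorem IsEigensystem.clamped {lam : ℕ → ℝ} {u : ℕ → ℝ → ℝ} (hu : IsEigensystem k lam u) :
    IsEigensystem (clampKernel k) lam u where
  antitone := hu.antitone
  eigen i := (satisfiesEigenEq_clampKernel_iff _ _).2 (hu.eigen i)
  orthonormal := hu.orthonormal
  complete c v hc hv := hu.complete c v hc ((satisfiesEigenEq_clampKernel_iff _ _).1 hv)

theorem sqDist_clampKernel (k' : ℝ → ℝ → ℝ) : sqDist (clampKernel k) k' = sqDist k k' :=
  setIntegral_congr_fun (measurableSet_Icc.prod measurableSet_Icc) fun p hp => by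
    simp only [clampKernel_of_mem k hp.1 hp.2]

/-- The eigenvalues of a covariance kernel are nonnegative. -/
theorem IsEigensystem.eigenvalue_nonneg {lam : ℕ → ℝ} {u : ℕ → ℝ → ℝ}
    (hu : IsEigensystem k lam u) (hk : IsCovarianceKernel k) (i : ℕ) : 0 ≤ lam i := by
  obtain ⟨hL, he⟩ := hu.clamped.eigen i
  have h := integral_kernel_mul_mul_nonneg hk.measurable_clampKernel hk.memLp_clampKernel
    hk.sum_clampKernel_nonneg hL
  have hI : Integrable (fun p : ℝ × ℝ => clampKernel k p.1 p.2 * (u i p.1 * u i p.2))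
      ((volume.restrict I).prod (volume.restrict I)) :=
    hk.memLp_clampKernel.integrable_mul (memLp_two_mul_prod hL hL)
  rw [integral_prod _ hI] at h
  have h1 : ∫ x in I, ∫ y in I, clampKernel k x y * (u i x * u i y) =
      ∫ x in I, lam i * (u i x * u i x) := by
    refine integral_congr_ae ?_
    filter_upwards [he] with x hx
    rw [← mul_assoc, ← hx, integralOp, ← integral_mul_const]
    refine integral_congr_ae (.of_forall fun y => ?_)
    simp only
    ring
  rw [h1, integral_const_mul, hu.orthonormal, if_pos rfl, mul_one] at h
  exact h

end Clamp

/-! ### Compact symmetric operators and Ky Fan's inequality. -/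

section Hilbert

open scoped InnerProductSpace

variable {E : Type*} [NormedAddCommGroup E] [InnerProductSpace ℝ E] [CompleteSpace E]

/-- A compact symmetric operator vanishes on the orthogonal complement of a family of
eigenvectors that misses no eigenvector with nonzero eigenvalue. -/
theorem apply_eq_zero_of_forall_inner_eq_zero {T : E →L[ℝ] E} (hT : IsCompactOperator T)
    (hs : T.IsSymmetric) {U : ℕ → E} {lam : ℕ → ℝ}
    (hU : ∀ i, T (U i) = lam i • U i)
    (hc : ∀ (c : ℝ) (v : E), c ≠ 0 → T v = c • v → (∀ i, ⟪U i, v⟫_ℝ = 0) → v = 0)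
    {w : E} (hw : ∀ i, ⟪U i, w⟫_ℝ = 0) : T w = 0 := by
  set V : Submodule ℝ E := (Submodule.span ℝ (Set.range U))ᗮ with hV
  have memV : ∀ v, v ∈ V ↔ ∀ i, ⟪U i, v⟫_ℝ = 0 := by
    intro v
    constructor
    · intro h i
      exact (Submodule.mem_orthogonal _ _).1 h _ (Submodule.subset_span ⟨i, rfl⟩)
    · intro h
      have : Submodule.span ℝ (Set.range U) ≤ (ℝ ∙ v)ᗮ := by
        rw [Submodule.span_le]
        rintro _ ⟨i, rfl⟩
        rw [SetLike.mem_coe, Submodule.mem_orthogonal_singleton_iff_inner_left]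
        exact h i
      refine (Submodule.mem_orthogonal _ _).2 fun u hu => ?_
      exact (Submodule.mem_orthogonal_singleton_iff_inner_left).1 (this hu)
  have inv : ∀ v ∈ V, T v ∈ V := by
    intro v hv
    rw [memV] at hv ⊢
    intro i
    have := hs (U i) v
    simp only [ContinuousLinearMap.coe_coe] at this
    rw [← this, hU, inner_smul_left, hv]
    simp
  let S : V →L[ℝ] V := T.restrict inv
  have hSc : IsCompactOperator S := hT.restrict' inv
  have hSs : S.IsSymmetric := hs.restrict_invariant inv
  -- The complement is `T`-invariant, and an eigenvector there with nonzero eigenvalue would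
  -- contradict completeness; a compact symmetric operator without nonzero eigenvalues is zero.
  have hS : S = 0 := by
    rw [← ContinuousLinearMap.eq_zero_of_forall_hasEigenvalue_eq_zero hSc hSs]
    intro c hc'
    by_contra hne
    obtain ⟨v, hv⟩ := hc'.exists_hasEigenvector
    apply hv.2
    have h1 : S v = c • v := hv.apply_eq_smul
    have h2 : T (v : E) = c • (v : E) := congrArg Subtype.val h1
    exact Subtype.ext (hc c v hne h2 ((memV _).1 v.2))
  have h3 : S ⟨w, (memV w).2 hw⟩ = 0 := by rw [hS]; rfl
  exact congrArg Subtype.val h3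

theorem norm_apply_sum_sq_le {E : Type*} [NormedAddCommGroup E] [InnerProductSpace ℝ E]
    {T : E →L[ℝ] E} {U : ℕ → E} (hO : Orthonormal ℝ U)
    {lam : ℕ → ℝ} (hU : ∀ i, T (U i) = lam i • U i) (s : Finset ℕ) {L : ℝ}
    (hL : ∀ i ∈ s, lam i ^ 2 ≤ L ^ 2) (c : ℕ → ℝ) :
    ‖T (∑ i ∈ s, c i • U i)‖ ^ 2 ≤ L ^ 2 * ‖∑ i ∈ s, c i • U i‖ ^ 2 := by
  have h1 : T (∑ i ∈ s, c i • U i) = ∑ i ∈ s, (c i * lam i) • U i := by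
    simp [map_sum, hU, smul_smul]
  have key : ∀ d : ℕ → ℝ, ‖∑ i ∈ s, d i • U i‖ ^ 2 = ∑ i ∈ s, d i ^ 2 := by
    intro d
    rw [← real_inner_self_eq_norm_sq, hO.inner_sum]
    simp [sq]
  rw [h1, key, key, Finset.mul_sum]
  refine Finset.sum_le_sum fun i hi => ?_
  rw [mul_pow, mul_comm]
  exact mul_le_mul_of_nonneg_right (hL i hi) (sq_nonneg _)

/-- On the orthogonal complement of the first `m` eigenvectors, the norm of a compact symmetric
operator is at most its next eigenvalue. -/
theorem norm_apply_le_of_inner_eq_zero {T : E →L[ℝ] E} (hT : IsCompactOperator T)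
    (hs : T.IsSymmetric) {U : ℕ → E} (hO : Orthonormal ℝ U) {lam : ℕ → ℝ}
    (hU : ∀ i, T (U i) = lam i • U i) (hlam : Antitone lam) (h0 : ∀ i, 0 ≤ lam i)
    (hc : ∀ (c : ℝ) (v : E), c ≠ 0 → T v = c • v → (∀ i, ⟪U i, v⟫_ℝ = 0) → v = 0)
    (m : ℕ) {w : E} (hw : ∀ i < m, ⟪U i, w⟫_ℝ = 0) : ‖T w‖ ≤ lam m * ‖w‖ := by
  -- The vector `w` is split along the closed span `S` of the eigenvectors of index at least `m`:
  -- the bound holds on finite combinations, hence on `S`, and `T` kills the rest of `w`.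
  set W : Submodule ℝ E := (Submodule.span ℝ (U '' Set.Ici m)) with hW
  set S := W.topologicalClosure with hS
  have hcl : IsClosed (S : Set E) := W.isClosed_topologicalClosure
  have : CompleteSpace S := hcl.completeSpace_coe
  have hSU : ∀ i, m ≤ i → U i ∈ S := fun i hi =>
    W.le_topologicalClosure (Submodule.subset_span ⟨i, hi, rfl⟩)
  -- vectors in the closed span of the remaining eigenvectors
  have hb : ∀ s ∈ S, ‖T s‖ ≤ lam m * ‖s‖ := by
    intro s hs
    have hs' : s ∈ closure (W : Set E) := hs
    have hsub : closure (W : Set E) ⊆ {s | ‖T s‖ ≤ lam m * ‖s‖} := by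
      refine closure_minimal ?_ (isClosed_le (by fun_prop) (by fun_prop))
      intro s hs
      have hs2 : s ∈ Submodule.span ℝ (U '' Set.Ici m) := hs
      rw [Finsupp.mem_span_image_iff_linearCombination] at hs2
      obtain ⟨l, hl, rfl⟩ := hs2
      have := norm_apply_sum_sq_le hO hU l.support (L := lam m) (fun i hi => by
        have : m ≤ i := (Finsupp.mem_supported ℝ l).1 hl hi
        exact pow_le_pow_left₀ (h0 i) (hlam this) 2) l
      rw [← mul_pow] at this
      exact abs_le_of_sq_le_sq' this (mul_nonneg (h0 m) (norm_nonneg _)) |>.2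
    exact hsub hs'
  have hoS : ∀ i < m, ∀ s ∈ S, ⟪U i, s⟫_ℝ = 0 := by
    intro i hi s hs
    have hsub : closure (W : Set E) ⊆ {s | ⟪U i, s⟫_ℝ = 0} := by
      refine closure_minimal ?_ (isClosed_eq (by fun_prop) continuous_const)
      have : W ≤ (ℝ ∙ (U i))ᗮ := by
        rw [hW, Submodule.span_le]
        rintro _ ⟨j, hj, rfl⟩
        rw [SetLike.mem_coe, Submodule.mem_orthogonal_singleton_iff_inner_right]
        exact hO.2 (by rintro rfl; exact absurd (Set.mem_Ici.1 hj) (by omega))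
      intro s hs
      exact (Submodule.mem_orthogonal_singleton_iff_inner_right).1 (this hs)
    exact hsub hs
  set p : E := S.starProjection w with hp
  have hpS : p ∈ S := Submodule.starProjection_apply_mem S w
  have hort : ∀ s ∈ S, ⟪s, w - p⟫_ℝ = 0 := fun s hs =>
    (Submodule.mem_orthogonal _ _).1 (S.sub_starProjection_mem_orthogonal w) s hs
  -- The difference `w - p` is orthogonal to every `U i`: for `i < m` both `w` and `p` are, and for
  -- `i ≥ m` because `U i ∈ S`.
  have hz : T (w - p) = 0 := by
    refine apply_eq_zero_of_forall_inner_eq_zero hT hs hU hc fun i => ?_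
    by_cases hi : i < m
    · rw [inner_sub_right, hw i hi, hoS i hi p hpS, sub_zero]
    · exact hort _ (hSU i (by omega))
  have hTw : T w = T p := by rw [map_sub, sub_eq_zero] at hz; exact hz
  rw [hTw]
  refine (hb p hpS).trans (mul_le_mul_of_nonneg_left ?_ (h0 m))
  exact S.norm_starProjection_apply_le w

/-- **Ky Fan's inequality** for the square of a compact symmetric operator. -/
theorem sum_norm_apply_sq_le {T : E →L[ℝ] E} (hT : IsCompactOperator T)
    (hs : T.IsSymmetric) {U : ℕ → E} (hO : Orthonormal ℝ U) {lam : ℕ → ℝ}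
    (hU : ∀ i, T (U i) = lam i • U i) (hlam : Antitone lam) (h0 : ∀ i, 0 ≤ lam i)
    (hc : ∀ (c : ℝ) (v : E), c ≠ 0 → T v = c • v → (∀ i, ⟪U i, v⟫_ℝ = 0) → v = 0)
    (m : ℕ) {ι : Type*} [Fintype ι] {v : ι → E} (hv : Orthonormal ℝ v)
    (hm : Fintype.card ι ≤ m) :
    ∑ j, ‖T (v j)‖ ^ 2 ≤ ∑ i ∈ Finset.range m, lam i ^ 2 := by
  set c : ℕ → ι → ℝ := fun i j => ⟪U i, v j⟫_ℝ with hcdef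
  -- Split `v j` into its projection `p` on the first `m` eigenvectors and the remainder; the images
  -- under `T` are still orthogonal, and `T` is bounded by `lam m` on the remainder.
  have h1 : ∀ j, ‖T (v j)‖ ^ 2 ≤ ∑ i ∈ Finset.range m, lam i ^ 2 * c i j ^ 2 +
      lam m ^ 2 * (1 - ∑ i ∈ Finset.range m, c i j ^ 2) := by
    intro j
    set p : E := ∑ i ∈ Finset.range m, c i j • U i with hp
    have hUp : ∀ i < m, ⟪U i, p⟫_ℝ = c i j := fun i hi => by
      rw [hp, hO.inner_right_sum _ (Finset.mem_range.2 hi)]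
    have hw : ∀ i < m, ⟪U i, v j - p⟫_ℝ = 0 := fun i hi => by
      rw [inner_sub_right, hUp i hi]; simp [hcdef]
    have hTw := norm_apply_le_of_inner_eq_zero hT hs hO hU hlam h0 hc m hw
    have hTp : T p = ∑ i ∈ Finset.range m, (c i j * lam i) • U i := by
      simp [hp, map_sum, hU, smul_smul]
    have hnTp : ‖T p‖ ^ 2 = ∑ i ∈ Finset.range m, lam i ^ 2 * c i j ^ 2 := by
      rw [← real_inner_self_eq_norm_sq, hTp, hO.inner_sum]
      refine Finset.sum_congr rfl fun i _ => ?_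
      simp; ring
    have hnp : ‖p‖ ^ 2 = ∑ i ∈ Finset.range m, c i j ^ 2 := by
      rw [← real_inner_self_eq_norm_sq, hp, hO.inner_sum]
      refine Finset.sum_congr rfl fun i _ => ?_
      simp; ring
    have hvp : ‖v j - p‖ ^ 2 = 1 - ∑ i ∈ Finset.range m, c i j ^ 2 := by
      have h2 : ⟪p, v j - p⟫_ℝ = 0 := by
        conv_lhs => rw [hp, sum_inner]
        refine Finset.sum_eq_zero fun i hi => ?_
        rw [inner_smul_left, hw i (Finset.mem_range.1 hi), mul_zero]
      have h3 := norm_add_sq_real p (v j - p)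
      rw [h2, add_sub_cancel, hv.1 j, hnp] at h3
      linarith
    have horth : ⟪T p, T (v j - p)⟫_ℝ = 0 := by
      rw [hTp, sum_inner]
      refine Finset.sum_eq_zero fun i hi => ?_
      have h4 := hs (U i) (v j - p)
      simp only [ContinuousLinearMap.coe_coe] at h4
      rw [inner_smul_left, ← h4, hU, inner_smul_left, hw i (Finset.mem_range.1 hi), mul_zero,
        mul_zero]
    have h5 := norm_add_sq_real (T p) (T (v j - p))
    rw [horth, ← map_add, add_sub_cancel, hnTp] at h5
    have h6 : ‖T (v j - p)‖ ^ 2 ≤ lam m ^ 2 * ‖v j - p‖ ^ 2 := by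
      rw [← mul_pow]; exact pow_le_pow_left₀ (norm_nonneg _) hTw 2
    rw [hvp] at h6
    linarith
  -- Bessel's inequality for the unit vector `U i` and the orthonormal family `v`.
  have h2 : ∀ i, ∑ j, c i j ^ 2 ≤ 1 := by
    intro i
    have := hv.sum_inner_products_le (s := Finset.univ) (U i)
    rw [hO.1 i] at this
    simpa [hcdef, real_inner_comm] using this
  -- Regrouping exposes the weights `lam i ^ 2 - lam m ^ 2`, nonnegative for `i < m`, so Bessel's
  -- inequality may be applied term by term.
  have h3 : ∑ j, ‖T (v j)‖ ^ 2 ≤ ∑ i ∈ Finset.range m, (lam i ^ 2 - lam m ^ 2) * ∑ j, c i j ^ 2 +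
      Fintype.card ι * lam m ^ 2 := by
    refine (Finset.sum_le_sum fun j _ => h1 j).trans (le_of_eq ?_)
    simp only [mul_sub, mul_one, Finset.sum_add_distrib, Finset.sum_sub_distrib, sub_mul,
      Finset.mul_sum]
    rw [Finset.sum_comm, Finset.sum_comm (s := Finset.univ)]
    simp
    ring
  have h4 : ∑ i ∈ Finset.range m, (lam i ^ 2 - lam m ^ 2) * ∑ j, c i j ^ 2 ≤
      ∑ i ∈ Finset.range m, (lam i ^ 2 - lam m ^ 2) := by
    refine Finset.sum_le_sum fun i hi => ?_
    refine mul_le_of_le_one_right ?_ (h2 i)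
    exact sub_nonneg.2 (pow_le_pow_left₀ (h0 m) (hlam (Finset.mem_range.1 hi).le) 2)
  have h5 : (Fintype.card ι : ℝ) * lam m ^ 2 ≤ m * lam m ^ 2 := by
    have : (Fintype.card ι : ℝ) ≤ m := by exact_mod_cast hm
    gcongr
  simp only [Finset.sum_sub_distrib, Finset.sum_const, Finset.card_range, nsmul_eq_mul] at h4
  simp only [Finset.sum_sub_distrib, sub_mul] at h3 h4
  linarith

end Hilbert

/-! ### The integral operator on `L²` and its compactness. -/

section Operator

open scoped InnerProductSpace

/-- Lebesgue measure on `[-1, 1]`. -/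
noncomputable abbrev mu : Measure ℝ := volume.restrict I

theorem inner_toLp_toLp {α : Type*} [MeasurableSpace α] {μ : Measure α} {f g : α → ℝ}
    (hf : MemLp f 2 μ) (hg : MemLp g 2 μ) :
    ⟪hf.toLp f, hg.toLp g⟫_ℝ = ∫ x, f x * g x ∂μ := by
  rw [L2.inner_def]
  refine integral_congr_ae ?_
  filter_upwards [hf.coeFn_toLp, hg.coeFn_toLp] with x h1 h2
  rw [h1, h2, Real.inner_apply]

theorem norm_sq_eq_integral_of_ae_eq {α : Type*} [MeasurableSpace α] {μ : Measure α} {f : α → ℝ}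
    (w : Lp ℝ 2 μ) (h : w =ᵐ[μ] f) : ‖w‖ ^ 2 = ∫ x, f x ^ 2 ∂μ := by
  rw [← real_inner_self_eq_norm_sq, L2.inner_def]
  refine integral_congr_ae ?_
  filter_upwards [h] with x h1
  rw [h1, Real.inner_apply, sq]

theorem coeFn_sum_smul {α ι : Type*} [MeasurableSpace α] {μ : Measure α} {p : ENNReal}
    (s : Finset ι) (c : ι → ℝ) (U : ι → Lp ℝ p μ) :
    (∑ i ∈ s, c i • U i : Lp ℝ p μ) =ᵐ[μ] fun x => ∑ i ∈ s, c i * U i x := by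
  classical
  induction s using Finset.induction_on with
  | empty =>
    simp only [Finset.sum_empty]
    exact Lp.coeFn_zero _ _ _
  | insert a s ha ih =>
    simp only [Finset.sum_insert ha]
    filter_upwards [Lp.coeFn_add (c a • U a) (∑ i ∈ s, c i • U i), Lp.coeFn_smul (c a) (U a), ih]
      with x h1 h2 h3
    rw [h1, Pi.add_apply, h2, h3]
    rfl

/-- A bounded continuous kernel on the plane. -/
structure IsBddContKernel (k : ℝ → ℝ → ℝ) (M : ℝ) : Prop where
  continuous : Continuous fun p : ℝ × ℝ => k p.1 p.2
  bound : ∀ x y, |k x y| ≤ M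

variable {k : ℝ → ℝ → ℝ} {M : ℝ}

theorem IsBddContKernel.memLp_slice (h : IsBddContKernel k M) (x : ℝ) :
    MemLp (k x) 2 mu :=
  MemLp.of_bound (h.continuous.comp (by fun_prop : Continuous fun y : ℝ => (x, y))
    ).aestronglyMeasurable M (.of_forall (h.bound x))

theorem IsBddContKernel.memLp (h : IsBddContKernel k M) :
    MemLp (fun p : ℝ × ℝ => k p.1 p.2) 2 (mu.prod mu) :=
  MemLp.of_bound h.continuous.aestronglyMeasurable M (.of_forall fun p => h.bound p.1 p.2)

/-- The section `k x ·` as an element of `L²`. -/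
noncomputable def slice (h : IsBddContKernel k M) (x : ℝ) : Lp ℝ 2 mu := (h.memLp_slice x).toLp _

theorem inner_slice (h : IsBddContKernel k M) (x : ℝ) (v : Lp ℝ 2 mu) :
    ⟪slice h x, v⟫_ℝ = integralOp k v x := by
  rw [L2.inner_def]
  refine integral_congr_ae ?_
  filter_upwards [(h.memLp_slice x).coeFn_toLp] with y h1
  rw [slice, h1, Real.inner_apply]

/-- The `L²` norm of the constant function `1`. -/
noncomputable def normOne : ℝ := (measureUnivNNReal mu : ℝ) ^ (2 : ENNReal).toReal⁻¹

theorem normOne_nonneg : 0 ≤ normOne := by unfold normOne; positivity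

theorem norm_le_normOne_mul {f : Lp ℝ 2 mu} {C : ℝ} (hC : 0 ≤ C) (h : ∀ᵐ x ∂mu, ‖f x‖ ≤ C) :
    ‖f‖ ≤ normOne * C := Lp.norm_le_of_ae_bound hC h

theorem IsBddContKernel.bound_nonneg (h : IsBddContKernel k M) : 0 ≤ M :=
  (abs_nonneg _).trans (h.bound 0 0)

theorem norm_slice_le (h : IsBddContKernel k M) (x : ℝ) : ‖slice h x‖ ≤ normOne * M := by
  refine norm_le_normOne_mul h.bound_nonneg ?_
  filter_upwards [(h.memLp_slice x).coeFn_toLp] with y h1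
  rw [slice, h1]
  exact h.bound x y

theorem stronglyMeasurable_inner_slice (h : IsBddContKernel k M) (v : Lp ℝ 2 mu) :
    StronglyMeasurable fun x => ⟪slice h x, v⟫_ℝ := by
  simp_rw [inner_slice, integralOp]
  exact StronglyMeasurable.integral_prod_right (f := fun x y => k x y * v y)
    (h.continuous.stronglyMeasurable.mul ((Lp.stronglyMeasurable v).comp_measurable measurable_snd))

theorem memLp_inner_slice (h : IsBddContKernel k M) (v : Lp ℝ 2 mu) :
    MemLp (fun x => ⟪slice h x, v⟫_ℝ) 2 mu :=
  MemLp.of_bound (stronglyMeasurable_inner_slice h v).aestronglyMeasurable (normOne * M * ‖v‖)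
    (.of_forall fun x => (norm_inner_le_norm _ _).trans
      (mul_le_mul_of_nonneg_right (norm_slice_le h x) (norm_nonneg _)))

/-- The integral operator with kernel `k`, as a bounded operator on `L²`. -/
noncomputable def opLp (h : IsBddContKernel k M) : Lp ℝ 2 mu →L[ℝ] Lp ℝ 2 mu :=
  LinearMap.mkContinuous
    { toFun := fun v => (memLp_inner_slice h v).toLp _
      map_add' := by
        intro v w
        rw [← MemLp.toLp_add]
        exact MemLp.toLp_congr _ _ (.of_forall fun x => inner_add_right _ _ _)
      map_smul' := by
        intro c v
        rw [RingHom.id_apply, ← MemLp.toLp_const_smul]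
        exact MemLp.toLp_congr _ _ (.of_forall fun x => inner_smul_right _ _ _) }
    (normOne * (normOne * M)) (by
      intro v
      have h0 := mul_nonneg (mul_nonneg normOne_nonneg h.bound_nonneg) (norm_nonneg v)
      rw [mul_assoc]
      refine norm_le_normOne_mul h0 ?_
      filter_upwards [(memLp_inner_slice h v).coeFn_toLp] with x hx
      simp only [LinearMap.coe_mk, AddHom.coe_mk, hx]
      exact (norm_inner_le_norm _ _).trans
        (mul_le_mul_of_nonneg_right (norm_slice_le h x) (norm_nonneg _)))

theorem coeFn_opLp (h : IsBddContKernel k M) (v : Lp ℝ 2 mu) :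
    opLp h v =ᵐ[mu] fun x => ⟪slice h x, v⟫_ℝ := (memLp_inner_slice h v).coeFn_toLp

theorem isSymmetric_opLp (h : IsBddContKernel k M) (hs : ∀ x y, k x y = k y x) :
    (opLp h).IsSymmetric := by
  intro v w
  have hI : Integrable (fun p : ℝ × ℝ => k p.1 p.2 * (w p.1 * v p.2)) (mu.prod mu) :=
    h.memLp.integrable_mul (memLp_two_mul_prod (Lp.memLp w) (Lp.memLp v))
  have h1 : ⟪opLp h v, w⟫_ℝ = ∫ x, ∫ y, k x y * (w x * v y) ∂mu ∂mu := by
    rw [L2.inner_def]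
    refine integral_congr_ae ?_
    filter_upwards [coeFn_opLp h v] with x hx
    rw [hx, Real.inner_apply, inner_slice, integralOp, ← integral_mul_const]
    refine integral_congr_ae (.of_forall fun y => ?_)
    simp only
    ring
  have h2 : ⟪v, opLp h w⟫_ℝ = ∫ y, ∫ x, k x y * (w x * v y) ∂mu ∂mu := by
    rw [L2.inner_def]
    refine integral_congr_ae ?_
    filter_upwards [coeFn_opLp h w] with y hy
    rw [hy, Real.inner_apply, inner_slice, integralOp, ← integral_const_mul]
    refine integral_congr_ae (.of_forall fun x => ?_)
    simp only
    rw [hs y x]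
    ring
  have h3 := integral_integral_swap (f := fun x y => k x y * (w x * v y)) hI
  exact h1.trans (h3.trans h2.symm)

/-- The sections of `k` over `[-1, 1]` are within distance `ε` of the subspace `V`. -/
def SlicesNear (h : IsBddContKernel k M) (V : Submodule ℝ (Lp ℝ 2 mu)) (ε : ℝ) : Prop :=
  ∀ x ∈ I, ∃ w ∈ V, ‖slice h x - w‖ ≤ ε

/-- Precomposing with the projection on `V` gives a finite-rank operator, and `(T v)(x)` is the
pairing of `v` with a section. Replacing `v` by its projection on `V` thus changes `T v` uniformly
by at most `ε ‖v‖`, so `T` is a norm limit of finite-rank operators. -/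
theorem isCompactOperator_opLp (h : IsBddContKernel k M)
    (hA : ∀ ε : ℝ, 0 < ε → ∃ V : Submodule ℝ (Lp ℝ 2 mu), FiniteDimensional ℝ V ∧
      SlicesNear h V ε) : IsCompactOperator (opLp h) := by
  choose V hV hVe using fun n : ℕ => hA (1 / ((n : ℝ) + 1)) (by positivity)
  have hlim : Tendsto (fun n => opLp h ∘L (V n).starProjection) atTop (nhds (opLp h)) := by
    rw [tendsto_iff_norm_sub_tendsto_zero]
    have hz : Tendsto (fun n : ℕ => normOne * (1 / ((n : ℝ) + 1))) atTop (nhds 0) := by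
      simpa using tendsto_one_div_add_atTop_nhds_zero_nat.const_mul normOne
    refine squeeze_zero (fun _ => norm_nonneg _) (fun n => ?_) hz
    refine ContinuousLinearMap.opNorm_le_bound _
      (mul_nonneg normOne_nonneg (by positivity)) fun v => ?_
    set P := (V n).starProjection
    have e : (opLp h ∘L P - opLp h) v = -(opLp h (v - P v)) := by
      simp
    rw [e, norm_neg, mul_assoc]
    refine norm_le_normOne_mul (by positivity) ?_
    filter_upwards [coeFn_opLp h (v - P v), ae_restrict_mem measurableSet_Icc] with x hx hxI
    obtain ⟨w, hw, hwe⟩ := hVe n x hxI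
    have h0 : ⟪w, v - P v⟫_ℝ = 0 :=
      (Submodule.mem_orthogonal _ _).1 ((V n).sub_starProjection_mem_orthogonal v) w hw
    have h1 : ⟪slice h x, v - P v⟫_ℝ = ⟪slice h x - w, v - P v⟫_ℝ := by
      rw [inner_sub_left, h0, sub_zero]
    rw [hx, h1]
    refine (norm_inner_le_norm _ _).trans (mul_le_mul hwe ?_ (norm_nonneg _) (by positivity))
    have := (V n)ᗮ.norm_starProjection_apply_le v
    rwa [Submodule.starProjection_orthogonal_val] at this
  refine isCompactOperator_of_tendsto hlim (.of_forall fun n => ?_)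
  have : ProperSpace (V n) := FiniteDimensional.proper ℝ (V n)
  exact (isCompactOperator_of_locallyCompactSpace_dom
    (V n).orthogonalProjectionOnto).clm_comp (opLp h ∘L (V n).subtypeL)

end Operator

/-! ### The truncation error and Schmidt's theorem. -/

section Schmidt

open scoped InnerProductSpace

variable {k : ℝ → ℝ → ℝ} {M : ℝ} {lam : ℕ → ℝ} {u : ℕ → ℝ → ℝ}

theorem IsEigensystem.memLp (hu : IsEigensystem k lam u) (i : ℕ) : MemLp (u i) 2 mu :=
  (hu.eigen i).1

/-- The eigenfunctions as elements of `L²`. -/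
noncomputable def eigenLp (hu : IsEigensystem k lam u) (i : ℕ) : Lp ℝ 2 mu :=
  (hu.memLp i).toLp _

theorem orthonormal_eigenLp (hu : IsEigensystem k lam u) : Orthonormal ℝ (eigenLp hu) := by
  rw [orthonormal_iff_ite]
  intro i j
  rw [eigenLp, eigenLp, inner_toLp_toLp, hu.orthonormal]

theorem inner_slice_toLp (h : IsBddContKernel k M) (x : ℝ) {v : ℝ → ℝ} (hv : MemLp v 2 mu) :
    ⟪slice h x, hv.toLp v⟫_ℝ = integralOp k v x := by
  rw [inner_slice]
  refine integral_congr_ae ?_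
  filter_upwards [hv.coeFn_toLp] with y hy
  rw [hy]

theorem ae_inner_slice_eigenLp (h : IsBddContKernel k M) (hu : IsEigensystem k lam u) (i : ℕ) :
    ∀ᵐ x ∂mu, ⟪slice h x, eigenLp hu i⟫_ℝ = lam i * u i x := by
  filter_upwards [(hu.eigen i).2] with x hx
  rw [eigenLp, inner_slice_toLp, hx]

theorem opLp_eigenLp (h : IsBddContKernel k M) (hu : IsEigensystem k lam u) (i : ℕ) :
    opLp h (eigenLp hu i) = lam i • eigenLp hu i := by
  refine Lp.ext ?_
  filter_upwards [coeFn_opLp h (eigenLp hu i), ae_inner_slice_eigenLp h hu i,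
    Lp.coeFn_smul (lam i) (eigenLp hu i), (hu.memLp i).coeFn_toLp] with x h1 h2 h3 h4
  rw [h1, h2, h3, Pi.smul_apply, eigenLp, h4, smul_eq_mul]

theorem eigenLp_complete (h : IsBddContKernel k M) (hu : IsEigensystem k lam u) (c : ℝ)
    (v : Lp ℝ 2 mu) (hc : c ≠ 0) (hv : opLp h v = c • v)
    (ho : ∀ i, ⟪eigenLp hu i, v⟫_ℝ = 0) : v = 0 := by
  rw [Lp.eq_zero_iff_ae_eq_zero]
  refine hu.complete c v hc ⟨Lp.memLp v, ?_⟩ fun i => ?_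
  · filter_upwards [coeFn_opLp h v, Lp.coeFn_smul c v] with x h1 h2
    rw [← inner_slice h, ← h1, hv, h2]
    rfl
  · rw [← ho i, L2.inner_def]
    refine integral_congr_ae ?_
    filter_upwards [(hu.memLp i).coeFn_toLp] with x hx
    rw [eigenLp, hx, Real.inner_apply]

theorem integrable_norm_slice_sq (h : IsBddContKernel k M) :
    Integrable (fun x => ‖slice h x‖ ^ 2) mu := by
  have h1 : ∀ x, ‖slice h x‖ ^ 2 = ∫ y, k x y ^ 2 ∂mu := fun x =>
    norm_sq_eq_integral_of_ae_eq _ (h.memLp_slice x).coeFn_toLp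
  simp_rw [h1]
  exact (h.memLp.integrable_sq).integral_prod_left

theorem memLp_klKernel (hu : IsEigensystem k lam u) (m : ℕ) :
    MemLp (fun p : ℝ × ℝ => klKernel lam u m p.1 p.2) 2 (mu.prod mu) := by
  simp only [klKernel, mul_assoc]
  exact memLp_finsetSum _ fun i _ =>
    (memLp_two_mul_prod (hu.memLp i) (hu.memLp i)).const_mul (lam i)

theorem sqDist_eq_integral (h : IsBddContKernel k M) (hu : IsEigensystem k lam u) (m : ℕ) :
    sqDist k (klKernel lam u m) = ∫ x, ∫ y, (k x y - klKernel lam u m x y) ^ 2 ∂mu ∂mu := by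
  rw [sqDist, Measure.volume_eq_prod, ← Measure.prod_restrict]
  exact integral_prod _ ((h.memLp.sub (memLp_klKernel hu m)).integrable_sq)

/-- For almost every `x` the eigenvalue equation says that `klKernel lam u m x ·` is the orthogonal
projection of `k x ·` on the first `m` eigenfunctions. Pythagoras, then integration over `x`, gives
the formula. -/
theorem sqDist_eq (h : IsBddContKernel k M) (hu : IsEigensystem k lam u) (m : ℕ) :
    sqDist k (klKernel lam u m) =
      ∫ x, ‖slice h x‖ ^ 2 ∂mu - ∑ i ∈ Finset.range m, lam i ^ 2 := by
  have hO := orthonormal_eigenLp hu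
  have key : ∀ᵐ x ∂mu, ∫ y, (k x y - klKernel lam u m x y) ^ 2 ∂mu =
      ‖slice h x‖ ^ 2 - ∑ i ∈ Finset.range m, lam i ^ 2 * u i x ^ 2 := by
    filter_upwards [ae_all_iff.2 fun i => ae_inner_slice_eigenLp h hu i] with x hx
    set p : Lp ℝ 2 mu := ∑ i ∈ Finset.range m, (lam i * u i x) • eigenLp hu i with hp
    have hae : (slice h x - p : Lp ℝ 2 mu) =ᵐ[mu] fun y => k x y - klKernel lam u m x y := by
      filter_upwards [Lp.coeFn_sub (slice h x) p, (h.memLp_slice x).coeFn_toLp,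
        coeFn_sum_smul (Finset.range m) (fun i => lam i * u i x) (eigenLp hu),
        ae_all_iff.2 fun i => (hu.memLp i).coeFn_toLp] with y h1 h2 h3 h4
      rw [h1, Pi.sub_apply, slice, h2, hp, h3, klKernel]
      simp only [eigenLp, h4]
    rw [← norm_sq_eq_integral_of_ae_eq _ hae, norm_sub_sq_real]
    have h5 : ⟪slice h x, p⟫_ℝ = ∑ i ∈ Finset.range m, lam i ^ 2 * u i x ^ 2 := by
      rw [hp, inner_sum]
      refine Finset.sum_congr rfl fun i _ => ?_
      rw [inner_smul_right, hx i]
      ring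
    have h6 : ‖p‖ ^ 2 = ∑ i ∈ Finset.range m, lam i ^ 2 * u i x ^ 2 := by
      rw [← real_inner_self_eq_norm_sq, hp, hO.inner_sum]
      refine Finset.sum_congr rfl fun i _ => ?_
      simp; ring
    rw [h5, h6]
    ring
  have hi : ∀ i ∈ Finset.range m, Integrable (fun x => lam i ^ 2 * u i x ^ 2) mu := fun i _ =>
    (hu.memLp i).integrable_sq.const_mul _
  rw [sqDist_eq_integral h hu, integral_congr_ae key,
    integral_sub (integrable_norm_slice_sq h) (integrable_finsetSum _ hi), integral_finsetSum _ hi]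
  congr 1
  refine Finset.sum_congr rfl fun i _ => ?_
  have := hu.orthonormal i i
  rw [if_pos rfl] at this
  simp_rw [integral_const_mul, sq (u i _)]
  rw [this, mul_one]

/-- **Schmidt's approximation theorem**: among the kernels of rank `m`, the truncated
eigenexpansion is closest to `k`. -/
theorem sqDist_le_of_slicesNear (h : IsBddContKernel k M) (hs : ∀ x y, k x y = k y x)
    (hu : IsEigensystem k lam u) (h0 : ∀ i, 0 ≤ lam i) (hT : IsCompactOperator (opLp h))
    {m : ℕ} {V : Submodule ℝ (Lp ℝ 2 mu)} [FiniteDimensional ℝ V]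
    (hV : Module.finrank ℝ V ≤ m) {ε : ℝ} (hε : SlicesNear h V ε) :
    sqDist k (klKernel lam u m) ≤ 2 * ε ^ 2 := by
  set b := stdOrthonormalBasis ℝ V with hb
  set v : Fin (Module.finrank ℝ V) → Lp ℝ 2 mu := fun j => (b j : Lp ℝ 2 mu) with hv
  have hvo : Orthonormal ℝ v := b.orthonormal.comp_linearIsometry V.subtypeₗᵢ
  have hfan := sum_norm_apply_sq_le hT (isSymmetric_opLp h hs) (orthonormal_eigenLp hu)
    (opLp_eigenLp h hu) hu.antitone h0 (eigenLp_complete h hu) m hvo (by simpa using hV)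
  -- The sum is the squared norm of the projection of the section on `V`; a point `w` of `V` within
  -- `ε` bounds what is left by `ε ^ 2`.
  have hpt : ∀ x ∈ I, ‖slice h x‖ ^ 2 ≤ ε ^ 2 + ∑ j, ⟪slice h x, v j⟫_ℝ ^ 2 := by
    intro x hx
    obtain ⟨w, hw, hwe⟩ := hε x hx
    set a : Fin (Module.finrank ℝ V) → ℝ := fun j => b.repr ⟨w, hw⟩ j with ha
    have hwa : w = ∑ j, a j • v j := by
      have := congrArg Subtype.val (b.sum_repr ⟨w, hw⟩)
      simp only [Submodule.coe_sum, Submodule.coe_smul] at this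
      exact this.symm
    have h1 : ⟪slice h x, w⟫_ℝ = ∑ j, a j * ⟪slice h x, v j⟫_ℝ := by
      rw [hwa, inner_sum]
      simp only [inner_smul_right]
    have h2 : ‖w‖ ^ 2 = ∑ j, a j ^ 2 := by
      rw [← real_inner_self_eq_norm_sq, hwa, hvo.inner_sum]
      simp [sq]
    have h3 := norm_sub_sq_real (slice h x) w
    have h4 : ‖slice h x - w‖ ^ 2 ≤ ε ^ 2 := pow_le_pow_left₀ (norm_nonneg _) hwe 2
    have h5 : 0 ≤ ∑ j, (a j - ⟪slice h x, v j⟫_ℝ) ^ 2 := Finset.sum_nonneg fun j _ => sq_nonneg _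
    have h6 : ∑ j, (a j - ⟪slice h x, v j⟫_ℝ) ^ 2 = ∑ j, a j ^ 2 -
        2 * ∑ j, a j * ⟪slice h x, v j⟫_ℝ + ∑ j, ⟪slice h x, v j⟫_ℝ ^ 2 := by
      rw [Finset.mul_sum, ← Finset.sum_sub_distrib, ← Finset.sum_add_distrib]
      refine Finset.sum_congr rfl fun j _ => ?_
      ring
    rw [h1, h2] at h3
    linarith
  have hi : ∀ j, Integrable (fun x => ⟪slice h x, v j⟫_ℝ ^ 2) mu := fun j =>
    (memLp_inner_slice h (v j)).integrable_sq
  have hint : ∫ x, ‖slice h x‖ ^ 2 ∂mu ≤ ∫ x, (ε ^ 2 + ∑ j, ⟪slice h x, v j⟫_ℝ ^ 2) ∂mu := by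
    refine integral_mono_ae (integrable_norm_slice_sq h)
      ((integrable_const _).add (integrable_finsetSum _ fun j _ => hi j)) ?_
    filter_upwards [ae_restrict_mem measurableSet_Icc] with x hx using hpt x hx
  rw [integral_add (integrable_const _) (integrable_finsetSum _ fun j _ => hi j),
    integral_finsetSum _ fun j _ => hi j] at hint
  -- Integrating the squared coefficients over `x` produces the quantities in Ky Fan's inequality.
  have hn : ∀ j, ∫ x, ⟪slice h x, v j⟫_ℝ ^ 2 ∂mu = ‖opLp h (v j)‖ ^ 2 := fun j =>
    (norm_sq_eq_integral_of_ae_eq _ (coeFn_opLp h (v j))).symm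
  simp_rw [hn] at hint
  -- The factor `2` is the length of `[-1, 1]`.
  have hc : ∫ _, ε ^ 2 ∂mu = 2 * ε ^ 2 := by
    rw [integral_const]
    simp [Measure.real]
    norm_num
  rw [sqDist_eq h hu]
  linarith

end Schmidt

/-! ### Piecewise polynomial approximation of the sections. -/

section PiecewisePolynomial

open scoped InnerProductSpace

variable {k : ℝ → ℝ → ℝ} {M : ℝ} {lam : ℕ → ℝ} {u : ℕ → ℝ → ℝ}

theorem exists_slicesNear (h : IsBddContKernel k M) {ι : Type*} [Fintype ι] {b : ι → ℝ → ℝ}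
    (hb : ∀ i, MemLp (b i) 2 mu) {ε : ℝ} (hε : 0 ≤ ε)
    (ha : ∀ x ∈ I, ∃ a : ι → ℝ, ∀ y ∈ I, |k x y - ∑ i, a i * b i y| ≤ ε) :
    ∃ V : Submodule ℝ (Lp ℝ 2 mu), FiniteDimensional ℝ V ∧
      Module.finrank ℝ V ≤ Fintype.card ι ∧ SlicesNear h V (normOne * ε) := by
  set B : ι → Lp ℝ 2 mu := fun i => (hb i).toLp (b i) with hB
  refine ⟨Submodule.span ℝ (Set.range B), FiniteDimensional.span_of_finite ℝ (Set.finite_range B),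
    finrank_range_le_card B, fun x hx => ?_⟩
  obtain ⟨a, ha⟩ := ha x hx
  refine ⟨∑ i, a i • B i, Submodule.sum_mem _ fun i _ => Submodule.smul_mem _ _
    (Submodule.subset_span ⟨i, rfl⟩), norm_le_normOne_mul hε ?_⟩
  filter_upwards [Lp.coeFn_sub (slice h x) (∑ i, a i • B i), (h.memLp_slice x).coeFn_toLp,
    coeFn_sum_smul Finset.univ a B, ae_all_iff.2 fun i => (hb i).coeFn_toLp,
    ae_restrict_mem measurableSet_Icc] with y h1 h2 h3 h4 hy
  rw [h1, Pi.sub_apply, slice, h2, h3]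
  simp only [hB, h4]
  exact ha y hy

/-- Near each `c ∈ [-1, 1]`, at distance at most `2 / N`, the sections `k x ·` are within `ε` of a
polynomial of degree less than `n`. -/
def LocallyPolyApprox (k : ℝ → ℝ → ℝ) (N n : ℕ) (ε : ℝ) : Prop :=
  ∀ x ∈ I, ∀ c ∈ I, ∃ P : Polynomial ℝ, P.natDegree < n ∧
    ∀ y ∈ I, |y - c| ≤ 2 / N → |k x y - P.eval y| ≤ ε

/-- The index of the cell containing `y` in the partition of `[-1, 1]` into `N` equal cells. -/
noncomputable def cellIndex (N : ℕ) (hN : 0 < N) (y : ℝ) : Fin N :=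
  -- The minimum puts the right endpoint `y = 1` into the last cell.
  ⟨min (N - 1) ⌊(y + 1) / 2 * N⌋₊, by omega⟩

theorem measurable_cellIndex (N : ℕ) (hN : 0 < N) : Measurable (cellIndex N hN) := by
  have h1 : Measurable fun y : ℝ => min (N - 1) ⌊(y + 1) / 2 * N⌋₊ :=
    measurable_const.min (Nat.measurable_floor.comp (by fun_prop))
  refine measurable_to_countable' fun p => ?_
  have : cellIndex N hN ⁻¹' {p} = (fun y : ℝ => min (N - 1) ⌊(y + 1) / 2 * N⌋₊) ⁻¹' {(p : ℕ)} := by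
    ext y
    simp [cellIndex, Fin.ext_iff]
  rw [this]
  exact h1 (measurableSet_singleton _)

/-- The left endpoint of a cell. -/
noncomputable def cellPoint {N : ℕ} (p : Fin N) : ℝ := -1 + 2 * (p : ℕ) / N

theorem cellPoint_mem {N : ℕ} (p : Fin N) : cellPoint p ∈ I := by
  have hN : (0 : ℝ) < N := by exact_mod_cast p.pos
  have hp : ((p : ℕ) : ℝ) ≤ N := by exact_mod_cast p.2.le
  have h1 : 0 ≤ 2 * ((p : ℕ) : ℝ) / N := by positivity
  have h2 : 2 * ((p : ℕ) : ℝ) / N ≤ 2 := by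
    rw [div_le_iff₀ hN]; linarith
  constructor <;> simp only [cellPoint] <;> linarith

theorem abs_sub_cellPoint_le {N : ℕ} (hN : 0 < N) {y : ℝ} (hy : y ∈ I) :
    |y - cellPoint (cellIndex N hN y)| ≤ 2 / N := by
  have hN' : (0 : ℝ) < N := by exact_mod_cast hN
  set t : ℝ := (y + 1) / 2 * N with ht
  have ht0 : 0 ≤ t := mul_nonneg (by linarith [hy.1]) hN'.le
  have htN : t ≤ N := by
    rw [ht]; exact mul_le_of_le_one_left hN'.le (by linarith [hy.2])
  have hy' : y - cellPoint (cellIndex N hN y) =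
      2 / N * (t - ((min (N - 1) ⌊t⌋₊ : ℕ) : ℝ)) := by
    simp only [cellPoint, cellIndex, ht]
    field_simp
    ring
  have h1 : ((min (N - 1) ⌊t⌋₊ : ℕ) : ℝ) ≤ t :=
    (Nat.cast_le.2 (min_le_right _ _)).trans (Nat.floor_le ht0)
  have h2 : t - ((min (N - 1) ⌊t⌋₊ : ℕ) : ℝ) ≤ 1 := by
    rcases min_choice (N - 1) ⌊t⌋₊ with h | h <;> rw [h]
    · rw [Nat.cast_sub hN]; push_cast; linarith
    · linarith [(Nat.lt_floor_add_one t).le]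
  rw [hy', abs_of_nonneg (mul_nonneg (by positivity) (by linarith))]
  exact mul_le_of_le_one_right (by positivity) h2

/-- The space is spanned by the `N * n` products of a cell indicator with a monomial; it does not
depend on `x`, only the coefficients do. -/
theorem LocallyPolyApprox.exists_slicesNear (h : IsBddContKernel k M) {N n : ℕ} (hN : 0 < N)
    {ε : ℝ} (hε : 0 ≤ ε) (hP : LocallyPolyApprox k N n ε) :
    ∃ V : Submodule ℝ (Lp ℝ 2 mu), FiniteDimensional ℝ V ∧
      Module.finrank ℝ V ≤ N * n ∧ SlicesNear h V (normOne * ε) := by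
  set b : Fin N × Fin n → ℝ → ℝ := fun q =>
    (cellIndex N hN ⁻¹' {q.1}).indicator fun y => y ^ (q.2 : ℕ) with hb
  have hbm : ∀ q, MemLp (b q) 2 mu := by
    intro q
    refine MemLp.indicator (measurable_cellIndex N hN (measurableSet_singleton _)) ?_
    refine MemLp.of_bound (by fun_prop) 1 ?_
    filter_upwards [ae_restrict_mem measurableSet_Icc] with y hy
    rw [norm_pow, Real.norm_eq_abs]
    exact pow_le_one₀ (abs_nonneg _) (abs_le.2 hy)
  have := KLExpansion.exists_slicesNear h hbm hε fun x hx => ?_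
  · simpa using this
  choose P hPd hPe using fun p : Fin N => hP x hx (cellPoint p) (cellPoint_mem p)
  refine ⟨fun q => (P q.1).coeff q.2, fun y hy => ?_⟩
  have hsum : ∑ q, (P q.1).coeff q.2 * b q y = (P (cellIndex N hN y)).eval y := by
    rw [Polynomial.eval_eq_sum_range' (hPd _), Finset.sum_range, Fintype.sum_prod_type,
      Finset.sum_eq_single (cellIndex N hN y)]
    · simp [hb]
    · intro p _ hp
      refine Finset.sum_eq_zero fun l _ => ?_
      have : y ∉ cellIndex N hN ⁻¹' {p} := fun h => hp h.symm
      simp only [hb, Set.indicator_of_notMem this, mul_zero]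
    · simp
  rw [hsum]
  exact hPe _ y hy (abs_sub_cellPoint_le hN hy)

theorem continuous_clampKernel (hc : ContinuousOn (fun p : ℝ × ℝ => k p.1 p.2) (I ×ˢ I)) :
    Continuous fun p : ℝ × ℝ => clampKernel k p.1 p.2 :=
  hc.comp_continuous (f := fun p : ℝ × ℝ => (clamp p.1, clamp p.2))
    ((continuous_clamp.comp continuous_fst).prodMk (continuous_clamp.comp continuous_snd))
    fun _ => ⟨clamp_mem _, clamp_mem _⟩

theorem exists_isBddContKernel_clampKernel
    (hc : ContinuousOn (fun p : ℝ × ℝ => k p.1 p.2) (I ×ˢ I)) :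
    ∃ M, IsBddContKernel (clampKernel k) M := by
  obtain ⟨M, hM⟩ := (isCompact_Icc.prod isCompact_Icc).exists_bound_of_continuousOn hc
  exact ⟨M, continuous_clampKernel hc,
    fun x y => hM (clamp x, clamp y) ⟨clamp_mem _, clamp_mem _⟩⟩

theorem LocallyPolyApprox.clamped {N n : ℕ} {ε : ℝ} (hP : LocallyPolyApprox k N n ε) :
    LocallyPolyApprox (clampKernel k) N n ε := by
  intro x hx c hcI
  obtain ⟨P, hd, he⟩ := hP x hx c hcI
  refine ⟨P, hd, fun y hy hyc => ?_⟩
  rw [clampKernel_of_mem k hx hy]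
  exact he y hy hyc

/-- Uniform continuity: on a small cell the section is nearly constant. This gives convergence
without a rate, enough for compactness and for letting the truncation order tend to infinity. -/
theorem exists_locallyPolyApprox_one
    (hc : ContinuousOn (fun p : ℝ × ℝ => k p.1 p.2) (I ×ˢ I)) {ε : ℝ} (hε : 0 < ε) :
    ∃ N : ℕ, 0 < N ∧ LocallyPolyApprox k N 1 ε := by
  have huc := (isCompact_Icc.prod isCompact_Icc).uniformContinuousOn_of_continuous hc
  rw [Metric.uniformContinuousOn_iff_le] at huc
  obtain ⟨δ, hδ, hd⟩ := huc ε hε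
  obtain ⟨N, hN⟩ := exists_nat_gt (2 / δ)
  have hN0 : (0 : ℝ) < N := lt_of_le_of_lt (by positivity) hN
  refine ⟨N, by exact_mod_cast hN0, fun x hx c hcI => ⟨Polynomial.C (k x c), by simp, ?_⟩⟩
  intro y hy hyc
  have := hd (x, y) ⟨hx, hy⟩ (x, c) ⟨hx, hcI⟩ (by
    rw [Prod.dist_eq, dist_self, Real.dist_eq]
    refine max_le hδ.le (hyc.trans ?_)
    rw [div_lt_iff₀ hδ] at hN
    rw [div_le_iff₀ hN0]
    linarith)
  simpa [Real.dist_eq] using this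

theorem isCompactOperator_opLp_clampKernel
    (hc : ContinuousOn (fun p : ℝ × ℝ => k p.1 p.2) (I ×ˢ I))
    (h : IsBddContKernel (clampKernel k) M) : IsCompactOperator (opLp h) := by
  refine isCompactOperator_opLp h fun ε hε => ?_
  -- Adding `1` avoids having to show that `normOne` is nonzero.
  have hp : 0 < normOne + 1 := by linarith [normOne_nonneg]
  obtain ⟨N, hN, hP⟩ := exists_locallyPolyApprox_one hc (div_pos hε hp)
  obtain ⟨V, hV, -, hnear⟩ := hP.clamped.exists_slicesNear h hN (by positivity)
  refine ⟨V, hV, fun x hx => ?_⟩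
  obtain ⟨w, hw, hle⟩ := hnear x hx
  refine ⟨w, hw, hle.trans ?_⟩
  rw [mul_div_assoc', div_le_iff₀ hp, mul_comm]
  exact mul_le_mul_of_nonneg_left (by linarith) hε.le

/-- The truncation error is controlled by the error of piecewise polynomial approximation. -/
theorem sqDist_le_of_locallyPolyApprox (hk : IsCovarianceKernel k)
    (hc : ContinuousOn (fun p : ℝ × ℝ => k p.1 p.2) (I ×ˢ I)) (hu : IsEigensystem k lam u)
    {N n m : ℕ} (hN : 0 < N) (hm : N * n ≤ m) {ε : ℝ} (hε : 0 ≤ ε)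
    (hP : LocallyPolyApprox k N n ε) :
    sqDist k (klKernel lam u m) ≤ 2 * normOne ^ 2 * ε ^ 2 := by
  obtain ⟨M, h⟩ := exists_isBddContKernel_clampKernel hc
  obtain ⟨V, hV, hr, hnear⟩ := hP.clamped.exists_slicesNear h hN hε
  rw [← sqDist_clampKernel, mul_assoc, ← mul_pow]
  exact sqDist_le_of_slicesNear h hk.clampKernel_comm hu.clamped (hu.eigenvalue_nonneg hk)
    (isCompactOperator_opLp_clampKernel hc h) (hr.trans hm) hnear

end PiecewisePolynomial

/-! ### The trace bound and the rate for continuous kernels. -/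

section Trace

open scoped InnerProductSpace

variable {k : ℝ → ℝ → ℝ} {M : ℝ} {lam : ℕ → ℝ} {u : ℕ → ℝ → ℝ}

theorem measureReal_mu_univ : mu.real Set.univ = 2 := by
  simp [Measure.real]
  norm_num

/-- Positivity of the quadratic form of `k` on the difference of a point mass and an
`L²` function. -/
theorem two_mul_inner_slice_le (h : IsBddContKernel k M)
    (hs : ∀ x y, k x y = k y x)
    (hpos : ∀ (N : ℕ) (x : Fin N → ℝ) (c : Fin N → ℝ),
      0 ≤ ∑ i, ∑ j, c i * c j * k (x i) (x j)) (x : ℝ) (v : Lp ℝ 2 mu) :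
    2 * ⟪slice h x, v⟫_ℝ ≤ k x x + ⟪v, opLp h v⟫_ℝ := by
  set L : ℝ := ∫ y, k x y * v y ∂mu with hL
  have hLi : Integrable (fun y => k x y * v y) mu := (h.memLp_slice x).integrable_mul (Lp.memLp v)
  have hQi : Integrable (fun p : ℝ × ℝ => k p.1 p.2 * (v p.1 * v p.2)) (mu.prod mu) :=
    h.memLp.integrable_mul (memLp_two_mul_prod (Lp.memLp v) (Lp.memLp v))
  have hQ : ∫ p, k p.1 p.2 * (v p.1 * v p.2) ∂(mu.prod mu) = ⟪v, opLp h v⟫_ℝ := by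
    rw [integral_prod _ hQi, L2.inner_def]
    refine integral_congr_ae ?_
    filter_upwards [coeFn_opLp h v] with y hy
    rw [hy, Real.inner_apply, inner_slice, integralOp, ← integral_const_mul]
    refine integral_congr_ae (.of_forall fun x => ?_)
    simp only
    ring
  have hdm : AEStronglyMeasurable (fun y => k y y) mu :=
    (h.continuous.comp (by fun_prop : Continuous fun y : ℝ => (y, y))).aestronglyMeasurable
  have hdi : Integrable (fun y => k y y * v y ^ 2) mu :=
    (Lp.memLp v).integrable_sq.bdd_mul hdm (.of_forall fun y => h.bound y y)
  have i1 : Integrable (fun _ : ℝ × ℝ => k x x / 4) (mu.prod mu) := integrable_const _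
  have i2 : Integrable (fun p : ℝ × ℝ => 1 / 2 * (k x p.1 * v p.1)) (mu.prod mu) :=
    (hLi.const_mul _).comp_fst mu
  have i3 : Integrable (fun p : ℝ × ℝ => 1 / 2 * (k x p.2 * v p.2)) (mu.prod mu) :=
    (hLi.const_mul _).comp_snd mu
  have i12 : Integrable (fun p : ℝ × ℝ => k x x / 4 - 1 / 2 * (k x p.1 * v p.1)) (mu.prod mu) :=
    i1.sub i2
  have i123 : Integrable (fun p : ℝ × ℝ => k x x / 4 - 1 / 2 * (k x p.1 * v p.1) -
      1 / 2 * (k x p.2 * v p.2)) (mu.prod mu) := i12.sub i3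
  -- The measure has mass `2`, and its square mass `4`; the factors `1 / 4` and `1 / 2` make the
  -- integral equal to `k x x - 2 L + ⟪v, T v⟫`, with `T` the operator `opLp h`.
  have key := integral_prod_nonneg_of_sum_nonneg' (μ := mu)
    (g := fun y z => k x x / 4 - 1 / 2 * (k x y * v y) - 1 / 2 * (k x z * v z) +
      k y z * (v y * v z)) (i123.add hQi) ?_ ?_
  · rw [integral_add i123 hQi, integral_sub i12 i3, integral_sub i1 i2, hQ,
      integral_fun_fst (fun y => 1 / 2 * (k x y * v y)),
      integral_fun_snd (fun y => 1 / 2 * (k x y * v y)), integral_const_mul, ← hL, integral_const,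
      ← Set.univ_prod_univ, measureReal_prod_prod, measureReal_mu_univ] at key
    rw [inner_slice]
    simp only [smul_eq_mul] at key
    change 2 * L ≤ _
    linarith
  · have := (((integrable_const (μ := mu) (k x x / 4)).sub (hLi.const_mul (1 / 2))).sub
      (hLi.const_mul (1 / 2))).add hdi
    refine this.congr (.of_forall fun y => ?_)
    simp only [Pi.add_apply, Pi.sub_apply]
    ring
  · intro N y
    -- The point `x` gets weight `-N / 2` against the `N` samples, which reproduces the double sum
    -- of `g` exactly.
    have h1 := hpos (N + 1) (Fin.cons x y) (Fin.cons (-(N : ℝ) / 2) fun i => v (y i))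
    simp only [Fin.sum_univ_succ, Fin.cons_zero, Fin.cons_succ, Finset.sum_add_distrib] at h1
    refine h1.trans (le_of_eq ?_)
    simp only [Finset.sum_add_distrib, Finset.sum_sub_distrib, Finset.sum_const, Finset.card_univ,
      Fintype.card_fin, nsmul_eq_mul, ← Finset.mul_sum]
    have e1 : ∑ i, -(N : ℝ) / 2 * v (y i) * k x (y i) = -(N : ℝ) / 2 * ∑ i, k x (y i) * v (y i) := by
      rw [Finset.mul_sum]
      exact Finset.sum_congr rfl fun i _ => by ring
    have e2 : ∑ i, v (y i) * (-(N : ℝ) / 2) * k (y i) x =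
        -(N : ℝ) / 2 * ∑ i, k x (y i) * v (y i) := by
      rw [Finset.mul_sum]
      exact Finset.sum_congr rfl fun i _ => by rw [hs (y i) x]; ring
    have e3 : ∑ i, ∑ j, v (y i) * v (y j) * k (y i) (y j) =
        ∑ i, ∑ j, k (y i) (y j) * (v (y i) * v (y j)) :=
      Finset.sum_congr rfl fun i _ => Finset.sum_congr rfl fun j _ => by ring
    rw [e1, e2, e3]
    ring

/-- The sum of the eigenvalues is at most the trace of the kernel. -/
theorem sum_eigenvalues_le (h : IsBddContKernel k M) (hs : ∀ x y, k x y = k y x)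
    (hpos : ∀ (N : ℕ) (x : Fin N → ℝ) (c : Fin N → ℝ),
      0 ≤ ∑ i, ∑ j, c i * c j * k (x i) (x j))
    (hu : IsEigensystem k lam u) (m : ℕ) : ∑ i ∈ Finset.range m, lam i ≤ 2 * M := by
  have hO := orthonormal_eigenLp hu
  have key : ∀ᵐ x ∂mu, ∑ i ∈ Finset.range m, lam i * u i x ^ 2 ≤ M := by
    filter_upwards [ae_all_iff.2 fun i => ae_inner_slice_eigenLp h hu i] with x hx
    -- With this `v` both pairings equal `∑ lam i * u i x ^ 2`, so the inequality reads `∑ lam i * u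
    -- i x ^ 2 ≤ k x x`.
    set v : Lp ℝ 2 mu := ∑ i ∈ Finset.range m, u i x • eigenLp hu i with hv
    have h1 := two_mul_inner_slice_le h hs hpos x v
    have h2 : ⟪slice h x, v⟫_ℝ = ∑ i ∈ Finset.range m, lam i * u i x ^ 2 := by
      rw [hv, inner_sum]
      refine Finset.sum_congr rfl fun i _ => ?_
      rw [inner_smul_right, hx i]
      ring
    have h3 : opLp h v = ∑ i ∈ Finset.range m, (u i x * lam i) • eigenLp hu i := by
      simp [hv, map_sum, opLp_eigenLp h hu, smul_smul]
    have h4 : ⟪v, opLp h v⟫_ℝ = ∑ i ∈ Finset.range m, lam i * u i x ^ 2 := by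
      rw [h3, hv, hO.inner_sum]
      refine Finset.sum_congr rfl fun i _ => ?_
      simp; ring
    rw [h2, h4] at h1
    have := (le_abs_self _).trans (h.bound x x)
    linarith
  have hi : ∀ i ∈ Finset.range m, Integrable (fun x => lam i * u i x ^ 2) mu := fun i _ =>
    (hu.memLp i).integrable_sq.const_mul _
  have h1 := integral_mono_ae (integrable_finsetSum _ hi) (integrable_const M) key
  rw [integral_finsetSum _ hi, integral_const, measureReal_mu_univ, smul_eq_mul] at h1
  refine le_trans (le_of_eq (Finset.sum_congr rfl fun i _ => ?_)) h1
  have := hu.orthonormal i i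
  rw [if_pos rfl] at this
  simp_rw [integral_const_mul, sq (u i _)]
  rw [this, mul_one]

/-- For continuous kernels the truncation error is `O(1 / m)`. -/
theorem exists_sqDist_le_div (hk : IsCovarianceKernel k)
    (hc : ContinuousOn (fun p : ℝ × ℝ => k p.1 p.2) (I ×ˢ I)) (hu : IsEigensystem k lam u) :
    ∃ C : ℝ, ∀ m : ℕ, sqDist k (klKernel lam u m) ≤ C / (m + 1) := by
  obtain ⟨M, h⟩ := exists_isBddContKernel_clampKernel hc
  have hM := h.bound_nonneg
  have h0 := hu.eigenvalue_nonneg hk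
  have htr := sum_eigenvalues_le h hk.clampKernel_comm hk.sum_clampKernel_nonneg hu.clamped
  refine ⟨2 * M * (2 * M), fun m => ?_⟩
  -- The smallest of the first `m + 1` eigenvalues is at most their average.
  have hlm : lam m ≤ 2 * M / (m + 1) := by
    rw [le_div_iff₀ (by positivity)]
    refine le_trans ?_ (htr (m + 1))
    have : ∑ i ∈ Finset.range (m + 1), lam m ≤ ∑ i ∈ Finset.range (m + 1), lam i :=
      Finset.sum_le_sum fun i hi => hu.antitone (by simpa [Nat.lt_succ_iff] using hi)
    simpa [mul_comm] using this
  -- The errors at `m` and `n` differ by the eigenvalue squares in between, at most `lam m` times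
  -- the trace bound.
  have hstep : ∀ n, m ≤ n → sqDist k (klKernel lam u m) ≤
      sqDist k (klKernel lam u n) + 2 * M * (2 * M) / (m + 1) := by
    intro n hmn
    have e1 := sqDist_eq h hu.clamped m
    have e2 := sqDist_eq h hu.clamped n
    rw [sqDist_clampKernel] at e1 e2
    have e3 := Finset.sum_range_add_sum_Ico (fun i => lam i ^ 2) hmn
    have e4 : ∑ i ∈ Finset.Ico m n, lam i ^ 2 ≤ 2 * M / (m + 1) * ∑ i ∈ Finset.Ico m n, lam i := by
      rw [Finset.mul_sum]
      refine Finset.sum_le_sum fun i hi => ?_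
      rw [sq]
      exact mul_le_mul_of_nonneg_right ((hu.antitone (Finset.mem_Ico.1 hi).1).trans hlm) (h0 i)
    have e5 : ∑ i ∈ Finset.Ico m n, lam i ≤ 2 * M := by
      refine le_trans (Finset.sum_le_sum_of_subset_of_nonneg (fun i hi => ?_) fun i _ _ => h0 i)
        (htr n)
      exact Finset.mem_range.2 (Finset.mem_Ico.1 hi).2
    have e6 : 2 * M / (m + 1) * ∑ i ∈ Finset.Ico m n, lam i ≤ 2 * M / (m + 1) * (2 * M) :=
      mul_le_mul_of_nonneg_left e5 (by positivity)
    have e7 : 2 * M / ((m : ℝ) + 1) * (2 * M) = 2 * M * (2 * M) / (m + 1) := by ring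
    linarith
  -- It remains to make the error at `n` smaller than any `δ`, by piecewise constants.
  refine le_of_forall_pos_le_add fun δ hδ => ?_
  have hq : 0 < 2 * normOne ^ 2 + 1 := by positivity
  obtain ⟨N, hN, hP⟩ := exists_locallyPolyApprox_one hc (Real.sqrt_pos.2 (div_pos hδ hq))
  have h1 := sqDist_le_of_locallyPolyApprox hk hc hu (m := max m (N * 1)) hN (le_max_right _ _)
    (Real.sqrt_nonneg _) hP
  rw [Real.sq_sqrt (by positivity)] at h1
  have h2 : 2 * normOne ^ 2 * (δ / (2 * normOne ^ 2 + 1)) ≤ δ := by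
    rw [mul_div_assoc', div_le_iff₀ hq, mul_comm]
    exact mul_le_mul_of_nonneg_left (by linarith) hδ.le
  linarith [hstep _ (le_max_left m (N * 1))]

end Trace

/-! ### Taylor polynomials in the second variable. -/

section Taylor

/-- The Taylor polynomial with coefficients `a l / l!` at `c`. -/
noncomputable def taylorSum (a : ℕ → ℝ) (c : ℝ) (n : ℕ) (y : ℝ) : ℝ :=
  ∑ l ∈ Finset.range n, a l * (y - c) ^ l / (l.factorial : ℝ)

theorem hasDerivAt_taylorSum (a : ℕ → ℝ) (c : ℝ) (n : ℕ) (y : ℝ) :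
    HasDerivAt (taylorSum a c (n + 1)) (taylorSum (fun l => a (l + 1)) c n y) y := by
  have h : HasDerivAt (taylorSum a c (n + 1)) (∑ l ∈ Finset.range (n + 1),
      a l * (l * (y - c) ^ (l - 1) * 1) / (l.factorial : ℝ)) y := by
    unfold taylorSum
    exact HasDerivAt.fun_sum fun l _ =>
      ((((hasDerivAt_id y).sub_const c).pow l).const_mul (a l)).div_const _
  convert h using 1
  rw [Finset.sum_range_succ', taylorSum]
  simp only [Nat.cast_zero, zero_mul, mul_zero, zero_div, add_zero]
  refine Finset.sum_congr rfl fun l _ => ?_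
  rw [Nat.factorial_succ, Nat.add_sub_cancel]
  have : (l.factorial : ℝ) ≠ 0 := by exact_mod_cast l.factorial_ne_zero
  push_cast
  field_simp

theorem taylorSum_self (a : ℕ → ℝ) (c : ℝ) (n : ℕ) : taylorSum a c (n + 1) c = a 0 := by
  rw [taylorSum, Finset.sum_range_succ']
  simp

/-- Induction by the mean value inequality: the derivative of the remainder is the remainder, of
order one less, of the derivative. The factor `1 / n!` is given up, as only the power of `|y - c|`
matters. -/
theorem abs_sub_taylorSum_le (n : ℕ) : ∀ {φ : ℕ → ℝ → ℝ} {M : ℝ},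
    (∀ l < n, ∀ y ∈ I, HasDerivWithinAt (φ l) (φ (l + 1) y) I y) →
    (∀ y ∈ I, |φ n y| ≤ M) → ∀ c ∈ I, ∀ y ∈ I,
    |φ 0 y - taylorSum (fun l => φ l c) c n y| ≤ M * |y - c| ^ n := by
  induction n with
  | zero =>
    intro φ M _ hM c _ y hy
    simpa [taylorSum] using hM y hy
  | succ n ih =>
    intro φ M hd hM c hc y hy
    have ih' := ih (φ := fun l => φ (l + 1)) (fun l hl => hd (l + 1) (by omega)) hM c hc
    have hsub : Set.uIcc c y ⊆ I := Set.uIcc_subset_Icc hc hy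
    have hM0 : 0 ≤ M := (abs_nonneg _).trans (hM c hc)
    have := (convex_uIcc c y).norm_image_sub_le_of_norm_hasDerivWithin_le
      (f := fun y => φ 0 y - taylorSum (fun l => φ l c) c (n + 1) y)
      (f' := fun y => φ 1 y - taylorSum (fun l => φ (l + 1) c) c n y)
      (C := M * |y - c| ^ n)
      (fun t ht => ((hd 0 (by omega) t (hsub ht)).mono hsub).sub
        (hasDerivAt_taylorSum _ c n t).hasDerivWithinAt)
      (fun t ht => (ih' t (hsub ht)).trans (by
        have := Set.abs_sub_left_of_mem_uIcc ht
        gcongr))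
      Set.left_mem_uIcc Set.right_mem_uIcc
    simp only [taylorSum_self, sub_self, sub_zero] at this
    rw [pow_succ, ← mul_assoc]
    exact this

theorem exists_polynomial_eval_eq_taylorSum (a : ℕ → ℝ) (c : ℝ) {n : ℕ} (hn : 0 < n) :
    ∃ P : Polynomial ℝ, P.natDegree < n ∧ ∀ y, P.eval y = taylorSum a c n y := by
  refine ⟨∑ l ∈ Finset.range n, Polynomial.C (a l / (l.factorial : ℝ)) *
    (Polynomial.X - Polynomial.C c) ^ l, ?_, fun y => ?_⟩
  · refine lt_of_le_of_lt (Polynomial.natDegree_sum_le_of_forall_le (n := n - 1) _ _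
      fun l hl => ?_) (by omega)
    refine (Polynomial.natDegree_C_mul_le _ _).trans (Polynomial.natDegree_pow_le.trans ?_)
    rw [Polynomial.natDegree_X_sub_C, mul_one]
    have := Finset.mem_range.1 hl
    omega
  · rw [Polynomial.eval_finsetSum, taylorSum]
    refine Finset.sum_congr rfl fun l _ => ?_
    simp
    ring

/-- The partial derivative in the second variable within `[-1, 1]²`. -/
noncomputable def sndDeriv (f : ℝ × ℝ → ℝ) (p : ℝ × ℝ) : ℝ :=
  fderivWithin ℝ f (I ×ˢ I) p (0, 1)

theorem uniqueDiffOn_I : UniqueDiffOn ℝ I := uniqueDiffOn_Icc (by norm_num)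

theorem contDiffOn_iterate_sndDeriv (l : ℕ) : ∀ {n : ℕ} {f : ℝ × ℝ → ℝ},
    ContDiffOn ℝ ((n + l : ℕ) : ℕ∞ω) f (I ×ˢ I) → ContDiffOn ℝ n (sndDeriv^[l] f) (I ×ˢ I) := by
  induction l with
  | zero => intro n f hf; simpa using hf
  | succ l ih =>
    intro n f hf
    rw [Function.iterate_succ_apply]
    refine ih ?_
    have h := hf.fderivWithin (m := ((n + l : ℕ) : ℕ∞ω))
      (uniqueDiffOn_I.prod uniqueDiffOn_I) (by push_cast; rw [add_assoc])
    exact h.clm_apply contDiffOn_const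

theorem hasDerivWithinAt_sndDeriv {f : ℝ × ℝ → ℝ} (hf : ContDiffOn ℝ 1 f (I ×ˢ I)) {x y : ℝ}
    (hx : x ∈ I) (hy : y ∈ I) :
    HasDerivWithinAt (fun y => f (x, y)) (sndDeriv f (x, y)) I y := by
  have h1 := ((hf.differentiableOn one_ne_zero) (x, y) ⟨hx, hy⟩).hasFDerivWithinAt
  have h2 : HasDerivWithinAt (fun y : ℝ => (x, y)) (0, 1) I y :=
    (hasDerivWithinAt_const y I x).prodMk (hasDerivWithinAt_id y I)
  exact h1.comp_hasDerivWithinAt y h2 fun t ht => ⟨hx, ht⟩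

end Taylor

/-! ### Power series restricted to lines. -/

section Analytic

/-- Expand by multilinearity over the set `s` of slots that receive `t • e`; each such term is a
constant times `t ^ s.card`. -/
theorem exists_polynomial_eval_eq_multilinear {E : Type*} [AddCommGroup E] [Module ℝ E] {l : ℕ}
    (f : MultilinearMap ℝ (fun _ : Fin l => E) ℝ) (A e : E) :
    ∃ P : Polynomial ℝ, P.natDegree ≤ l ∧ ∀ t : ℝ, P.eval t = f fun _ => A + t • e := by
  classical
  refine ⟨∑ s : Finset (Fin l), Polynomial.C (f (s.piecewise (fun _ => e) fun _ => A)) *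
    Polynomial.X ^ s.card, ?_, fun t => ?_⟩
  · refine Polynomial.natDegree_sum_le_of_forall_le _ _ fun s _ => ?_
    refine (Polynomial.natDegree_C_mul_X_pow_le _ _).trans ?_
    simpa using s.card_le_univ
  · have h := f.map_add_univ (fun _ => t • e) (fun _ => A)
    have h' : (fun _ : Fin l => A + t • e) = (fun _ => t • e) + fun _ => A := by
      ext; simp [add_comm]
    rw [h', h, Polynomial.eval_finsetSum]
    refine Finset.sum_congr rfl fun s _ => ?_
    have h2 := f.map_piecewise_smul (fun _ => t) (s.piecewise (fun _ => e) fun _ => A) s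
    have h3 : s.piecewise (fun i => t • (s.piecewise (fun _ => e) (fun _ => A) : Fin l → E) i)
        (s.piecewise (fun _ => e) fun _ => A) = s.piecewise (fun _ => t • e) fun _ => A := by
      ext i
      by_cases hi : i ∈ s <;> simp [hi]
    rw [h3] at h2
    rw [h2, Polynomial.eval_mul, Polynomial.eval_C, Polynomial.eval_pow, Polynomial.eval_X,
      Finset.prod_const, smul_eq_mul, mul_comm]

theorem exists_polynomial_eval_eq_partialSum {E : Type*} [NormedAddCommGroup E] [NormedSpace ℝ E]
    (p : FormalMultilinearSeries ℝ E ℝ) (A e : E) {n : ℕ} (hn : 0 < n) :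
    ∃ P : Polynomial ℝ, P.natDegree < n ∧ ∀ t : ℝ, P.eval t = p.partialSum n (A + t • e) := by
  choose P hd he using fun l =>
    exists_polynomial_eval_eq_multilinear (p l).toMultilinearMap A e
  refine ⟨∑ l ∈ Finset.range n, P l, ?_, fun t => ?_⟩
  · refine lt_of_le_of_lt (Polynomial.natDegree_sum_le_of_forall_le (n := n - 1) _ _
      fun l hl => ?_) (by omega)
    have := Finset.mem_range.1 hl
    exact (hd l).trans (by omega)
  · rw [Polynomial.eval_finsetSum, FormalMultilinearSeries.partialSum]
    exact Finset.sum_congr rfl fun l _ => he l t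

end Analytic

/-! ### Decay rates. -/

section Rates

variable {k : ℝ → ℝ → ℝ} {lam : ℕ → ℝ} {u : ℕ → ℝ → ℝ}

theorem exists_locallyPolyApprox_of_contDiffOn {j : ℕ} (hj : 0 < j)
    (hc : ContDiffOn ℝ j (fun p : ℝ × ℝ => k p.1 p.2) (I ×ˢ I)) :
    ∃ C : ℝ, 0 ≤ C ∧ ∀ N : ℕ, LocallyPolyApprox k N j (C * (1 / N) ^ j) := by
  set f : ℝ × ℝ → ℝ := fun p => k p.1 p.2 with hf
  have hcd : ∀ l ≤ j, ContDiffOn ℝ ((j - l : ℕ) : ℕ∞ω) (sndDeriv^[l] f) (I ×ˢ I) := by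
    intro l hl
    apply contDiffOn_iterate_sndDeriv
    rwa [Nat.sub_add_cancel hl]
  obtain ⟨M, hM⟩ := (isCompact_Icc.prod isCompact_Icc).exists_bound_of_continuousOn
    (hcd j le_rfl).continuousOn
  have hM0 : 0 ≤ M := (norm_nonneg _).trans (hM (0, 0) (by constructor <;> constructor <;> norm_num))
  -- The factor `2 ^ j` comes from the cell width `2 / N`.
  refine ⟨M * 2 ^ j, by positivity, fun N x hx c hcI => ?_⟩
  obtain ⟨P, hd, he⟩ := exists_polynomial_eval_eq_taylorSum
    (fun l => sndDeriv^[l] f (x, c)) c hj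
  refine ⟨P, hd, fun y hy hyc => ?_⟩
  have h := abs_sub_taylorSum_le j (φ := fun l y => sndDeriv^[l] f (x, y)) (M := M)
    (fun l hl t ht => by
      simp only [Function.iterate_succ_apply']
      refine hasDerivWithinAt_sndDeriv ((hcd l hl.le).of_le ?_) hx ht
      have : 1 ≤ j - l := by omega
      exact_mod_cast this)
    (fun t ht => hM (x, t) ⟨hx, ht⟩) c hcI y hy
  rw [he]
  refine h.trans ?_
  rw [mul_assoc, ← mul_pow, mul_one_div]
  gcongr

theorem isBigO_sqDist_of_contDiffOn (hk : IsCovarianceKernel k) (hu : IsEigensystem k lam u)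
    (j : ℕ) (hc : ContDiffOn ℝ j (fun p : ℝ × ℝ => k p.1 p.2) (I ×ˢ I)) :
    (fun m : ℕ => sqDist k (klKernel lam u m)) =O[atTop] fun m : ℕ => 1 / (m : ℝ) ^ (j + 1) := by
  have hnn : ∀ m, 0 ≤ sqDist k (klKernel lam u m) := fun m =>
    integral_nonneg fun p => sq_nonneg _
  rcases Nat.eq_zero_or_pos j with rfl | hj
  · obtain ⟨C, hC⟩ := exists_sqDist_le_div hk hc.continuousOn hu
    refine IsBigO.of_bound C ?_
    filter_upwards [eventually_gt_atTop 0] with m hm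
    have hm' : (0 : ℝ) < m := by exact_mod_cast hm
    have hC0 : 0 ≤ C := by simpa using (hnn 0).trans (hC 0)
    rw [Real.norm_of_nonneg (hnn m), Real.norm_of_nonneg (by positivity), zero_add, pow_one,
      mul_one_div]
    exact (hC m).trans (by gcongr; linarith)
  · obtain ⟨C, hC0, hC⟩ := exists_locallyPolyApprox_of_contDiffOn hj hc
    -- With `m / j` cells and `j` coefficients per cell the dimension is at most `m`; rounding down
    -- costs at most a factor `2`, since `m / j ≥ 1`.
    refine IsBigO.of_bound (2 * normOne ^ 2 * (C * (2 * j) ^ j) ^ 2) ?_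
    filter_upwards [eventually_ge_atTop j] with m hm
    have hm1 : (1 : ℝ) ≤ m := by exact_mod_cast hj.trans_le hm
    have hN : 0 < m / j := Nat.div_pos hm hj
    have hN' : (0 : ℝ) < (m / j : ℕ) := by exact_mod_cast hN
    have h := sqDist_le_of_locallyPolyApprox hk hc.continuousOn hu hN (Nat.div_mul_le_self m j)
      (by positivity) (hC (m / j))
    rw [Real.norm_of_nonneg (hnn m), Real.norm_of_nonneg (by positivity)]
    refine h.trans ?_
    have hle : 1 / ((m / j : ℕ) : ℝ) ≤ 2 * j * (1 / m) := by
      rw [mul_one_div, div_le_div_iff₀ hN' (by linarith)]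
      have h1 : m < j * (m / j + 1) := by
        rw [mul_comm]; exact Nat.lt_mul_of_div_lt (Nat.lt_succ_self _) hj
      have h2 : j * (m / j + 1) ≤ 2 * j * (m / j) := by nlinarith
      have h3 : (m : ℝ) ≤ 2 * j * (m / j : ℕ) := by exact_mod_cast h1.le.trans h2
      linarith
    have h1 : C * (1 / ((m / j : ℕ) : ℝ)) ^ j ≤ C * (2 * j) ^ j * (1 / m) ^ j := by
      rw [mul_assoc, ← mul_pow]
      gcongr
    -- Here `j ≥ 1` is essential: `2j ≥ j + 1`.
    have h2 : ((1 / (m : ℝ)) ^ j) ^ 2 ≤ 1 / (m : ℝ) ^ (j + 1) := by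
      rw [← pow_mul, one_div_pow]
      exact one_div_le_one_div_of_le (by positivity) (pow_le_pow_right₀ hm1 (by omega))
    calc 2 * normOne ^ 2 * (C * (1 / ((m / j : ℕ) : ℝ)) ^ j) ^ 2
        ≤ 2 * normOne ^ 2 * (C * (2 * j) ^ j * (1 / m) ^ j) ^ 2 := by gcongr
      _ = 2 * normOne ^ 2 * (C * (2 * j) ^ j) ^ 2 * ((1 / (m : ℝ)) ^ j) ^ 2 := by ring
      _ ≤ _ := by gcongr

theorem exists_locallyPolyApprox_of_analyticOn
    (ha : AnalyticOn ℝ (fun p : ℝ × ℝ => k p.1 p.2) (I ×ˢ I)) :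
    ∃ (N : ℕ) (C a : ℝ), 0 < N ∧ 0 ≤ C ∧ 0 < a ∧ a < 1 ∧
      ∀ n : ℕ, 0 < n → LocallyPolyApprox k N n (C * a ^ n) := by
  set f : ℝ × ℝ → ℝ := fun p => k p.1 p.2 with hf
  have hloc : ∀ z : ℝ × ℝ, z ∈ I ×ˢ I → ∃ (p : FormalMultilinearSeries ℝ (ℝ × ℝ) ℝ) (r C a : ℝ),
      0 < r ∧ 0 ≤ C ∧ 0 < a ∧ a < 1 ∧ ∀ w ∈ Metric.ball z r, w ∈ I ×ˢ I → ∀ n,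
        |f w - p.partialSum n (w - z)| ≤ C * a ^ n := by
    intro z hz
    obtain ⟨p, r, hp⟩ := ha z hz
    obtain ⟨r', hr0, hr'⟩ := ENNReal.lt_iff_exists_nnreal_btwn.1 hp.r_pos
    obtain ⟨a, ha, C, hC, h⟩ := hp.uniform_geometric_approx hr'
    refine ⟨p, r', C, a, by exact_mod_cast hr0, hC.le, ha.1, ha.2, fun w hw hwI n => ?_⟩
    have := h (w - z) (by rwa [mem_ball_zero_iff, ← dist_eq_norm]) n
      (by rw [add_sub_cancel]; exact Set.mem_insert_of_mem _ hwI)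
    rwa [add_sub_cancel] at this
  choose! p r C a hr hC ha0 ha1 h using hloc
  have hcpt : IsCompact (I ×ˢ I) := isCompact_Icc.prod isCompact_Icc
  obtain ⟨t, htI, ht⟩ := hcpt.elim_nhds_subcover (fun z => Metric.ball z (r z))
    fun z hz => Metric.ball_mem_nhds z (hr z hz)
  have hne : t.Nonempty := by
    have h0 : ((0, 0) : ℝ × ℝ) ∈ I ×ˢ I := by constructor <;> constructor <;> norm_num
    obtain ⟨z, hz, -⟩ := Set.mem_iUnion₂.1 (ht h0)
    exact ⟨z, hz⟩
  -- A Lebesgue number of the finite cover: each vertical segment of half-length `2 / N < δ` lies in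
  -- one ball of geometric convergence, so one `N` serves all degrees.
  obtain ⟨δ, hδ, hleb⟩ := lebesgue_number_lemma_of_metric hcpt
    (c := fun z : t => Metric.ball (z : ℝ × ℝ) (r z)) (fun _ => Metric.isOpen_ball)
    (by simpa only [Set.iUnion_subtype] using ht)
  obtain ⟨N, hN⟩ := exists_nat_gt (2 / δ)
  have hN0 : (0 : ℝ) < N := lt_of_le_of_lt (by positivity) hN
  have hNδ : 2 / (N : ℝ) < δ := by
    rw [div_lt_iff₀ hδ] at hN
    rw [div_lt_iff₀ hN0]
    linarith
  obtain ⟨z0, hz0⟩ := hne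
  refine ⟨N, t.sup' ⟨z0, hz0⟩ C, t.sup' ⟨z0, hz0⟩ a, by exact_mod_cast hN0,
    (hC z0 (htI z0 hz0)).trans (t.le_sup' C hz0), (ha0 z0 (htI z0 hz0)).trans_le (t.le_sup' a hz0),
    (Finset.sup'_lt_iff _).2 fun z hz => ha1 z (htI z hz), fun n hn x hx c hc => ?_⟩
  obtain ⟨⟨z, hz⟩, hball⟩ := hleb (x, c) ⟨hx, hc⟩
  obtain ⟨P, hd, he⟩ := exists_polynomial_eval_eq_partialSum (p z) ((x, 0) - z) (0, 1) hn
  refine ⟨P, hd, fun y hy hyc => ?_⟩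
  have hy' : (x, y) ∈ Metric.ball z (r z) := hball (by
    rw [Metric.mem_ball, Prod.dist_eq, dist_self, Real.dist_eq]
    exact max_lt hδ (hyc.trans_lt hNδ))
  have e : ((x, 0) - z) + y • ((0, 1) : ℝ × ℝ) = (x, y) - z := by
    ext <;> simp
    ring
  rw [he, e]
  refine (h z (htI z hz) _ hy' ⟨hx, hy⟩ n).trans ?_
  have h1 := t.le_sup' C hz
  have h2 := t.le_sup' a hz
  have h3 := ha0 z (htI z hz)
  have h4 := (hC z (htI z hz)).trans h1
  gcongr

theorem exists_sqDist_le_of_analyticOn (hk : IsCovarianceKernel k) (hu : IsEigensystem k lam u)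
    (ha : AnalyticOn ℝ (fun p : ℝ × ℝ => k p.1 p.2) (I ×ˢ I)) :
    ∃ C ρ : ℝ, 0 < ρ ∧ ρ < 1 ∧ ∀ m : ℕ, sqDist k (klKernel lam u m) ≤ C * ρ ^ m := by
  obtain ⟨N, C, a, hN, hC, ha0, ha1, h⟩ := exists_locallyPolyApprox_of_analyticOn ha
  obtain ⟨C', hC'⟩ := exists_sqDist_le_div hk ha.continuousOn hu
  -- The polynomial degree bound is `m / N`, so the error per unit of `m` shrinks by the `N`-th root
  -- of `a`.
  set ρ : ℝ := a ^ ((N : ℝ)⁻¹) with hρ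
  have hρ0 : 0 < ρ := Real.rpow_pos_of_pos ha0 _
  have hρ1 : ρ < 1 := Real.rpow_lt_one ha0.le ha1 (by positivity)
  have hρN : ρ ^ N = a := Real.rpow_inv_natCast_pow ha0.le hN.ne'
  set B : ℝ := |C'| + 2 * normOne ^ 2 * C ^ 2 with hB
  have hB0 : 0 ≤ B := by positivity
  have key : ∀ m, sqDist k (klKernel lam u m) ≤ B * a ^ (m / N) := by
    intro m
    -- For `m < N` no polynomial is available; the bound for continuous kernels covers these `m`.
    rcases Nat.eq_zero_or_pos (m / N) with h0 | h0
    · rw [h0, pow_zero, mul_one]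
      have h1 : C' / ((m : ℝ) + 1) ≤ |C'| :=
        (div_le_div_of_nonneg_right (le_abs_self C') (by positivity)).trans
          (div_le_self (abs_nonneg _) (by linarith [m.cast_nonneg (α := ℝ)]))
      have h2 : 0 ≤ 2 * normOne ^ 2 * C ^ 2 := by positivity
      linarith [hC' m]
    · have h1 := sqDist_le_of_locallyPolyApprox hk ha.continuousOn hu hN (Nat.mul_div_le m N)
        (by positivity) (h (m / N) h0)
      have h2 : (a ^ (m / N)) ^ 2 ≤ a ^ (m / N) := by
        rw [sq]; exact mul_le_of_le_one_left (by positivity) (pow_le_one₀ ha0.le ha1.le)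
      calc _ ≤ 2 * normOne ^ 2 * (C * a ^ (m / N)) ^ 2 := h1
        _ = 2 * normOne ^ 2 * C ^ 2 * (a ^ (m / N)) ^ 2 := by ring
        _ ≤ 2 * normOne ^ 2 * C ^ 2 * a ^ (m / N) := by gcongr
        _ ≤ B * a ^ (m / N) := by
          gcongr
          linarith [abs_nonneg C']
  -- Dividing by `a` pays for rounding `m / N` down: `a * a ^ (m / N) = ρ ^ (N * (m / N + 1)) ≤ ρ ^
  -- m`.
  refine ⟨B / a, ρ, hρ0, hρ1, fun m => (key m).trans ?_⟩
  have h1 : a * a ^ (m / N) ≤ ρ ^ m := by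
    rw [← pow_succ', ← hρN, ← pow_mul]
    refine pow_le_pow_of_le_one hρ0.le hρ1.le ?_
    exact (Nat.lt_mul_of_div_lt (Nat.lt_succ_self _) hN).le.trans (le_of_eq (mul_comm _ _))
  calc B * a ^ (m / N) = B / a * (a * a ^ (m / N)) := by field_simp
    _ ≤ B / a * ρ ^ m := by gcongr

end Rates

end KLExpansion

theorem theorem360 (k : ℝ → ℝ → ℝ) (hk : KLExpansion.IsCovarianceKernel k)
    (lam : ℕ → ℝ) (u : ℕ → ℝ → ℝ) (hu : KLExpansion.IsEigensystem k lam u)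
    {Ω : Type*} [MeasurableSpace Ω] (P : Measure Ω) :
    -- the truncated expansion is a centred Gaussian process with covariance `klKernel lam u m`
    (∀ (m : ℕ) (α : Ω → EuclideanSpace ℝ (Fin m)),
      HasLaw α (multivariateGaussian 0 1) P →
      KLExpansion.IsGaussianProcessWith P
        (fun (x : KLExpansion.I) w => KLExpansion.klSum lam u (α w) x)
        (fun _ => 0)
        (fun x y => KLExpansion.klKernel lam u m x y)) ∧
    -- real-analytic kernels: exponential decay
    (AnalyticOn ℝ (fun p : ℝ × ℝ => k p.1 p.2) (KLExpansion.I ×ˢ KLExpansion.I) →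
      ∃ C ρ : ℝ, 0 < ρ ∧ ρ < 1 ∧
        ∀ m : ℕ, KLExpansion.sqDist k (KLExpansion.klKernel lam u m) ≤ C * ρ ^ m) ∧
    -- infinitely differentiable kernels: decay faster than every power
    (ContDiffOn ℝ ∞ (fun p : ℝ × ℝ => k p.1 p.2) (KLExpansion.I ×ˢ KLExpansion.I) →
      ∀ q : ℕ, (fun m : ℕ => KLExpansion.sqDist k (KLExpansion.klKernel lam u m))
        =O[atTop] fun m : ℕ => 1 / (m : ℝ) ^ q) ∧
    -- kernels with continuous derivatives up to order `j`
    (∀ j : ℕ, ContDiffOn ℝ j (fun p : ℝ × ℝ => k p.1 p.2) (KLExpansion.I ×ˢ KLExpansion.I) →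
      (fun m : ℕ => KLExpansion.sqDist k (KLExpansion.klKernel lam u m))
        =O[atTop] fun m : ℕ => 1 / (m : ℝ) ^ (j + 1)) := by

  refine ⟨fun m α hα => KLExpansion.isGaussianProcessWith_klSum (hu.eigenvalue_nonneg hk) u P m α hα,
    KLExpansion.exists_sqDist_le_of_analyticOn hk hu, fun hc q => ?_,
    fun j hc => KLExpansion.isBigO_sqDist_of_contDiffOn hk hu j hc⟩
  refine (KLExpansion.isBigO_sqDist_of_contDiffOn hk hu q
    (hc.of_le (by exact_mod_cast le_top))).trans (IsBigO.of_bound 1 ?_)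
  filter_upwards [eventually_gt_atTop 0] with m hm
  have hm1 : (1 : ℝ) ≤ m := by exact_mod_cast hm
  rw [Real.norm_of_nonneg (by positivity), Real.norm_of_nonneg (by positivity), one_mul]
  exact one_div_le_one_div_of_le (by positivity) (pow_le_pow_right₀ hm1 (Nat.le_succ q))
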